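/- Conventions. All $C^*$-algebras are complex and unital; $T(B)$ is the set of tracial states of $B$, extended to matrices by $\tau((b_{ij}))=\sum_i\tau(b_{ii})$; $P(B)$ is the set of projections of $B$; $B^\infty=\ell^\infty(\mathbb N,B)/c_0(B)$. $B$ has real rank zero if the invertible self-adjoint elements are dense in the self-adjoint elements. The order on projections over $B$ is determined by traces if, whenever $p,q\in M_\infty(B)=\bigcup_n M_n(B)$ are projections with $\tau(p)<\tau(q)$ for all $\tau\in T(B)$, there is $w\in M_\infty(B)$ with $w^*w=p$ and $ww^*\le q$. An automorphism $\alpha$ of $A$ has the Rohlin property if for every integer $k\ge 1$, every finite $F\subset A$ and every $\varepsilon>0$ there are projections $e^{(0)}_0,\dots,e^{(0)}_{k-1},e^{(1)}_0,\dots,e^{(1)}_{k}$ in $A$ such that $\sum_j e^{(0)}_j+\sum_j e^{(1)}_j=1$, $\|\alpha(e^{(i)}_j)-e^{(i)}_{j+1}\|<\varepsilon$ for $i=0,1$, $0\le j\le k+i-2$, and $\|[a,e^{(i)}_j]\|<\varepsilon$ for all $a\in F$, $i=0,1$, $0\le j\le k+i-1$. A separable $C^*$-algebra $A$ has property (SI)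 if for every $C^*$-algebra $B$ of real rank zero over which the order on projections is determined by traces, every unital embedding $A\subset B$, and all bounded sequences $(e_n),(f_n)$ of self-adjoint elements of $B$ that represent projections of $B^\infty\cap A'$ and satisfy 1. there is $c>0$ such that for all $p\in P(A)$ and $\varepsilon>0$ there is $N$ with $c\,\tau(p)-\varepsilon\le\tau(pf_np)$ for all $n\ge N$ and all $\tau\in T(B)$, 2. $\tau(e_n)\to0$ for every $\tau\in T(B)$, there is $(w_n)\in B^\infty\cap A'$ with $(w_n)^*(w_n)=(e_n)$, $(w_n)(w_n)^*\le(f_n)$ and $(w_n)^2=0$ in $B^\infty$. It has uniform property (SI) if the same holds with condition 2 replaced by: $\tau(e_n)\to 0$ uniformly in $\tau\in T(B)$. Proposition 3.7. Let $A$ be a separable unital $C^*$-algebra with a unique tracial state such that the order on projections over $A$ is determined by traces, and let $\alpha$ be an automorphism of $A$ with the Rohlin property. Suppose that the order on projections over the crossed product $A\rtimes_\alpha\mathbb Z$ is determined by traces. If $A$ has property (SI), then so does $A\rtimes_\alpha\mathbb Z$; and if $A$ has uniform property (SI), then so does $A\rtimes_\alpha\mathbb Z$. -/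

import Mathlib

open Filter Topology
open scoped ENNReal

universe u v

/-! ### Tracial states and the order on projections -/

/-- A tracial state of a unital C⋆-algebra: a positive linear functional `τ` with `τ 1 = 1` and
`τ (a * b) = τ (b * a)`. -/
structure TracialState (A : Type u) [CStarAlgebra A] where
  toLinearMap : A →ₗ[ℂ] ℂ
  map_one' : toLinearMap 1 = 1
  nonneg_re' : ∀ a : A, 0 ≤ (toLinearMap (star a * a)).re
  nonneg_im' : ∀ a : A, (toLinearMap (star a * a)).im = 0
  tracial' : ∀ a b : A, toLinearMap (a * b) = toLinearMap (b * a)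

/-- The real part of `τ a`; it equals `τ a` for self-adjoint `a`, the only elements to which
it is applied below. -/
noncomputable def TracialState.val {A : Type u} [CStarAlgebra A] (τ : TracialState A) (a : A) : ℝ :=
  (τ.toLinearMap a).re

/-- `A` has exactly one tracial state. -/
def HasUniqueTracialState (A : Type u) [CStarAlgebra A] : Prop :=
  ∃ τ : TracialState A, ∀ σ : TracialState A, σ = τ

/-- The canonical (unnormalized) extension of a tracial state to matrices, `∑ i, τ (p i i)`. -/
noncomputable def TracialState.matrixVal {A : Type u} [CStarAlgebra A] (τ : TracialState A) {n : ℕ}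
    (p : Matrix (Fin n) (Fin n) A) : ℝ :=
  ∑ i, τ.val (p i i)

/-- The order on projections over `A` is determined by traces: for projections `p`, `q` over `A`
with `τ p < τ q` for all tracial states `τ`, the projection `p` is Murray–von Neumann equivalent
to a subprojection of `q`.  Two projections in `M_∞(A) = ⋃ₙ Mₙ(A)` lie in a common `Mₙ(A)`, and
`w = q w p` then lies in it as well.  The inequality `w w* ≤ q` between projections is
written as `q (w w*) = w w*`. -/
def ProjectionOrderDeterminedByTraces (A : Type u) [CStarAlgebra A] : Prop :=
  ∀ (n : ℕ) (p q : Matrix (Fin n) (Fin n) A), IsStarProjection p → IsStarProjection q →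
    (∀ τ : TracialState A, τ.matrixVal p < τ.matrixVal q) →
      ∃ w : Matrix (Fin n) (Fin n) A, star w * w = p ∧ q * (w * star w) = w * star w

/-- Real rank zero: the invertible self-adjoint elements are dense in the self-adjoint elements. -/
def RealRankZero (A : Type u) [CStarAlgebra A] : Prop :=
  ∀ a : A, IsSelfAdjoint a → ∀ ε : ℝ, 0 < ε →
    ∃ b : A, IsSelfAdjoint b ∧ IsUnit b ∧ ‖a - b‖ < ε

/-! ### The sequence algebra `B^∞ = ℓ^∞(ℕ, B) / c₀(B)`

Elements of `B^∞` are handled through representing bounded sequences. -/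

/-- `x` belongs to `ℓ^∞(ℕ, B)`. -/
def BoundedSeq {B : Type v} [CStarAlgebra B] (x : ℕ → B) : Prop :=
  ∃ C : ℝ, ∀ n, ‖x n‖ ≤ C

/-- `x - y` belongs to `c₀(B)`; for bounded sequences: `x` and `y` represent the same element
of `B^∞`. -/
def EqModNull {B : Type v} [CStarAlgebra B] (x y : ℕ → B) : Prop :=
  Tendsto (fun n => ‖x n - y n‖) atTop (𝓝 0)

/-- `x` represents an element of the relative commutant `B^∞ ∩ A'`, where `A` is seen as a
subalgebra of `B` (and, as constant sequences, of `B^∞`) through `φ`. -/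
def RepresentsRelCommutant {A : Type u} [CStarAlgebra A] {B : Type v} [CStarAlgebra B]
    (φ : A →⋆ₐ[ℂ] B) (x : ℕ → B) : Prop :=
  BoundedSeq x ∧ ∀ a : A, EqModNull (fun n => x n * φ a) (fun n => φ a * x n)

/-- `x` consists of self-adjoint elements and represents a projection of `B^∞ ∩ A'`. -/
def RepresentsCentralProjection {A : Type u} [CStarAlgebra A] {B : Type v} [CStarAlgebra B]
    (φ : A →⋆ₐ[ℂ] B) (x : ℕ → B) : Prop :=
  RepresentsRelCommutant φ x ∧ (∀ n, IsSelfAdjoint (x n)) ∧ EqModNull (fun n => x n * x n) x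

/-! ### Property (SI) -/

/-- Condition (1): there is `c > 0` such that for every projection `p` of `A` and `ε > 0` one has
`c τ(p) - ε ≤ τ(p fₙ p)` for all large `n` and all tracial states `τ` of `B`. -/
def TraceBoundedBelow {A : Type u} [CStarAlgebra A] {B : Type v} [CStarAlgebra B]
    (φ : A →⋆ₐ[ℂ] B) (f : ℕ → B) : Prop :=
  ∃ c : ℝ, 0 < c ∧ ∀ p : A, IsStarProjection p → ∀ ε : ℝ, 0 < ε →
    ∃ N : ℕ, ∀ n, N ≤ n → ∀ τ : TracialState B,
      c * τ.val (φ p) - ε ≤ τ.val (φ p * f n * φ p)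

/-- Condition (2), pointwise: `τ(eₙ) → 0` for each tracial state `τ` of `B`. -/
def TraceTendsToZero {B : Type v} [CStarAlgebra B] (e : ℕ → B) : Prop :=
  ∀ τ : TracialState B, Tendsto (fun n => τ.val (e n)) atTop (𝓝 0)

/-- Condition (2), uniformly: `τ(eₙ) → 0` uniformly over the tracial states `τ` of `B`. -/
def TraceTendsToZeroUniformly {B : Type v} [CStarAlgebra B] (e : ℕ → B) : Prop :=
  ∀ ε : ℝ, 0 < ε → ∃ N : ℕ, ∀ n, N ≤ n → ∀ τ : TracialState B, |τ.val (e n)| < ε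

/-- The conclusion of property (SI): some `w ∈ B^∞ ∩ A'` satisfies `w* w = e`, `w w* ≤ f` and
`w² = 0` in `B^∞`.  Since `w w*` and `f` are projections of `B^∞`, the inequality says
`f (w w*) = w w*`. -/
def SmallIsometryExists {A : Type u} [CStarAlgebra A] {B : Type v} [CStarAlgebra B]
    (φ : A →⋆ₐ[ℂ] B) (e f : ℕ → B) : Prop :=
  ∃ w : ℕ → B, RepresentsRelCommutant φ w ∧
    EqModNull (fun n => star (w n) * w n) e ∧
    EqModNull (fun n => f n * (w n * star (w n))) (fun n => w n * star (w n)) ∧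
    EqModNull (fun n => w n * w n) (fun _ => 0)

/-- Property (SI) of a (separable) unital C⋆-algebra `A`, with the pointwise condition (2). -/
def PropertySI (A : Type u) [CStarAlgebra A] : Prop :=
  ∀ (B : Type v) [CStarAlgebra B], RealRankZero B → ProjectionOrderDeterminedByTraces B →
    ∀ φ : A →⋆ₐ[ℂ] B, Function.Injective φ →
      ∀ e f : ℕ → B, RepresentsCentralProjection φ e → RepresentsCentralProjection φ f →
        TraceBoundedBelow φ f → TraceTendsToZero e → SmallIsometryExists φ e f

/-- Property (SI) of a (separable) unital C⋆-algebra `A`, with the uniform condition (2). -/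
def UniformPropertySI (A : Type u) [CStarAlgebra A] : Prop :=
  ∀ (B : Type v) [CStarAlgebra B], RealRankZero B → ProjectionOrderDeterminedByTraces B →
    ∀ φ : A →⋆ₐ[ℂ] B, Function.Injective φ →
      ∀ e f : ℕ → B, RepresentsCentralProjection φ e → RepresentsCentralProjection φ f →
        TraceBoundedBelow φ f → TraceTendsToZeroUniformly e → SmallIsometryExists φ e f

/-! ### The Rohlin property -/

/-- The Rohlin property: for every `k ≥ 1`, finite `F ⊆ A` and `ε > 0` there are two towers of
projections `e 0 j` (`0 ≤ j < k`) and `e 1 j` (`0 ≤ j < k + 1`) with sum `1`, approximately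
permuted along each tower by `α` and approximately commuting with `F`. -/
def RohlinProperty {A : Type u} [CStarAlgebra A] (α : A ≃⋆ₐ[ℂ] A) : Prop :=
  ∀ k : ℕ, 1 ≤ k → ∀ (F : Finset A) (ε : ℝ), 0 < ε → ∃ e : ℕ → ℕ → A,
    (∀ i < 2, ∀ j < k + i, IsStarProjection (e i j)) ∧
    (∑ i ∈ Finset.range 2, ∑ j ∈ Finset.range (k + i), e i j = 1) ∧
    (∀ i < 2, ∀ j, j + 1 < k + i → ‖α (e i j) - e i (j + 1)‖ < ε) ∧
    (∀ a ∈ F, ∀ i < 2, ∀ j < k + i, ‖a * e i j - e i j * a‖ < ε)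

/-! ### The crossed product by an automorphism -/

/-- A covariant representation of `(A, α)` in a nonzero unital C⋆-algebra: a unital
⋆-homomorphism `π` and a unitary `U` with `U π(a) U* = π(α(a))`. -/
structure CovariantRep (A : Type u) [CStarAlgebra A] (α : A ≃⋆ₐ[ℂ] A) : Type (u + 1) where
  carrier : Type u
  [cstar : CStarAlgebra carrier]
  [nontriv : Nontrivial carrier]
  π : A →⋆ₐ[ℂ] carrier
  U : carrier
  unitary : U ∈ _root_.unitary carrier
  covariant : ∀ a : A, U * π a * star U = π (α a)

attribute [instance] CovariantRep.cstar CovariantRep.nontriv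

section CrossedProduct

variable {A : Type u} [CStarAlgebra A] (α : A ≃⋆ₐ[ℂ] A)

/-- The `ℓ^∞`-product of all covariant representations of `(A, α)`. -/
abbrev CovariantProduct : Type (u + 1) :=
  lp (fun ρ : CovariantRep A α => ρ.carrier) ∞

noncomputable instance CovariantProduct.instCStarAlgebra : CStarAlgebra (CovariantProduct α) where

/-- The family `(π(a))` over all covariant representations `(π, U)`. -/
noncomputable def CovariantProduct.of (a : A) : CovariantProduct α :=
  ⟨fun ρ => ρ.π a, memℓp_infty ⟨‖a‖, by
    rintro _ ⟨ρ, rfl⟩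
    exact NonUnitalStarAlgHom.norm_apply_le ρ.π a⟩⟩

/-- The family `(U)` over all covariant representations `(π, U)`. -/
noncomputable def CovariantProduct.u : CovariantProduct α :=
  ⟨fun ρ => ρ.U, memℓp_infty ⟨1, by
    rintro _ ⟨ρ, rfl⟩
    exact (CStarRing.norm_of_mem_unitary ρ.unitary).le⟩⟩

/-- The crossed product as a closed unital ⋆-subalgebra: it is generated by the universal copy of
`A` and the universal implementing unitary, so the norm of a ⋆-polynomial in them is the supremum of
its norms over all covariant representations (the full crossed product).  The C⋆-algebra
generated by the range of any covariant representation has cardinality at most `(#A) ^ ℵ₀`, so it is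
isomorphic to one in `Type u`, and representations in `Type u` suffice for the universal property. -/
noncomputable def crossedProductSubalgebra : StarSubalgebra ℂ (CovariantProduct α) :=
  (StarAlgebra.adjoin ℂ
    (Set.range (CovariantProduct.of α) ∪ {CovariantProduct.u α})).topologicalClosure

/-- The crossed product `A ⋊_α ℤ`. -/
def CrossedProduct : Type (u + 1) := crossedProductSubalgebra α

noncomputable instance CrossedProduct.instCStarAlgebra : CStarAlgebra (CrossedProduct α) :=
  StarSubalgebra.cstarAlgebra (crossedProductSubalgebra α)
    (h_closed := StarSubalgebra.isClosed_topologicalClosure _)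

end CrossedProduct

/-! Let `φ` embed `A ⋊ ℤ` in `B`, and let `U` be the image of the canonical unitary. Property (SI)
of `A`, applied to the restriction of `φ`, gives a `w` that commutes with `A` only. It is made to
commute with `U` by averaging over translates, and the Rohlin property keeps the average from
spoiling `w* w = e`.

For each `k`, bases of Rohlin towers form a central sequence of projections `p` in `A`, orthogonal
in the limit to their translates `α^j(p)`, `1 ≤ j < k`, and of trace at least some `c > 0`
(`RohlinProperty.exists_central_sequence`). Every limit point of the functionals `τ(· p)` is a
multiple of the unique trace, so `τ(q p)` is asymptotically at least `c τ(q)`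
(`TracialState.eventually_mul_val_sub_le`), and `p f p` inherits condition (1) from `f` once `p` is
slowed down (`exists_traceBoundedBelow_cut`). Now (SI) for `e` and `p f p` gives `w` with `p w = w`.

Put `v = k^(-1/2) ∑_{j<k} U^j w U^(-j)`. The cross terms contain `w* U^d w = w* (p U^d p) w = 0`,
and `e`, `f` commute with `U`, so `v` satisfies the same relations as `w`
(`small_isometry_conjAverage`); by telescoping, `‖U v U* - v‖ ≤ 2 ‖w‖ / √k`. A diagonal choice with
`k → ∞` gives commutation with `U` (`exists_invariant_smallIsometry`), hence with all of `A ⋊ ℤ`.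

That `A` embeds in the crossed product is `CrossedProduct.incl_injective`, from the regular
representation on `ℓ²(ℤ, H)`. Condition (2) concerns only `e` and the traces of `B`, so one argument
serves both versions of (SI). -/

/-! ### Bounded sequences modulo null sequences -/

section SequenceAlgebra

variable {B : Type v} [CStarAlgebra B]

theorem BoundedSeq.const (b : B) : BoundedSeq (fun _ : ℕ => b) := ⟨‖b‖, fun _ => le_rfl⟩

theorem BoundedSeq.star {x : ℕ → B} (hx : BoundedSeq x) : BoundedSeq (fun n => star (x n)) := by
  obtain ⟨C, hC⟩ := hx
  exact ⟨C, fun n => by simpa using hC n⟩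

theorem BoundedSeq.add {x y : ℕ → B} (hx : BoundedSeq x) (hy : BoundedSeq y) :
    BoundedSeq (fun n => x n + y n) := by
  obtain ⟨C, hC⟩ := hx
  obtain ⟨D, hD⟩ := hy
  exact ⟨C + D, fun n => (norm_add_le _ _).trans (add_le_add (hC n) (hD n))⟩

theorem BoundedSeq.neg {x : ℕ → B} (hx : BoundedSeq x) : BoundedSeq (fun n => -x n) := by
  obtain ⟨C, hC⟩ := hx
  exact ⟨C, fun n => by simpa using hC n⟩

theorem BoundedSeq.mul {x y : ℕ → B} (hx : BoundedSeq x) (hy : BoundedSeq y) :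
    BoundedSeq (fun n => x n * y n) := by
  obtain ⟨C, hC⟩ := hx
  obtain ⟨D, hD⟩ := hy
  exact ⟨C * D, fun n => (norm_mul_le _ _).trans
    (mul_le_mul (hC n) (hD n) (norm_nonneg _) ((norm_nonneg _).trans (hC n)))⟩

theorem BoundedSeq.sum {ι : Type*} (s : Finset ι) {x : ι → ℕ → B}
    (hx : ∀ i ∈ s, BoundedSeq (x i)) : BoundedSeq (fun n => ∑ i ∈ s, x i n) := by
  classical
  induction s using Finset.induction_on with
  | empty => simpa using BoundedSeq.const (0 : B)
  | insert i s hi ih =>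
    simp only [Finset.sum_insert hi]
    exact (hx i (by simp)).add (ih fun j hj => hx j (by simp [hj]))

variable (B) in
/-- The ring `ℓ^∞(ℕ, B)`. -/
def boundedSeqSubring : Subring (ℕ → B) where
  carrier := {x | BoundedSeq x}
  mul_mem' hx hy := hx.mul hy
  one_mem' := BoundedSeq.const 1
  add_mem' hx hy := hx.add hy
  zero_mem' := BoundedSeq.const 0
  neg_mem' hx := hx.neg

variable (B) in
/-- The ideal `c₀(B)` of `ℓ^∞(ℕ, B)`. -/
def nullSeqIdeal : Ideal (boundedSeqSubring B) where
  carrier := {x | Tendsto (fun n => ‖x.1 n‖) atTop (𝓝 0)}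
  add_mem' {x y} hx hy := by
    have h := Tendsto.add hx hy
    rw [add_zero] at h
    exact squeeze_zero (fun n => norm_nonneg _) (fun n => norm_add_le _ _) h
  zero_mem' := by simp
  smul_mem' c x hx := by
    obtain ⟨C, hC⟩ := c.2
    have h := Tendsto.const_mul C hx
    rw [mul_zero] at h
    exact squeeze_zero (fun n => norm_nonneg _) (fun n => (norm_mul_le _ _).trans
      (mul_le_mul_of_nonneg_right (hC n) (norm_nonneg _))) h

instance : (nullSeqIdeal B).IsTwoSided where
  mul_mem_of_left {x} c hx := by
    obtain ⟨C, hC⟩ := c.2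
    have h := Tendsto.mul_const C hx
    rw [zero_mul] at h
    exact squeeze_zero (fun n => norm_nonneg _) (fun n => (norm_mul_le _ _).trans
      (mul_le_mul_of_nonneg_left (hC n) (norm_nonneg _))) h

variable (B) in
/-- The sequence algebra `B^∞`, as a ring. -/
def SeqAlgebra := boundedSeqSubring B ⧸ nullSeqIdeal B

noncomputable instance : Ring (SeqAlgebra B) :=
  inferInstanceAs (Ring (boundedSeqSubring B ⧸ nullSeqIdeal B))

/-- The class of a bounded sequence in `B^∞`. -/
def seqClass (x : ℕ → B) (hx : BoundedSeq x) : SeqAlgebra B :=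
  Ideal.Quotient.mk (nullSeqIdeal B) ⟨x, hx⟩

theorem seqClass_eq_iff {x y : ℕ → B} {hx : BoundedSeq x} {hy : BoundedSeq y} :
    seqClass x hx = seqClass y hy ↔ EqModNull x y :=
  Ideal.Quotient.eq

theorem seqClass_mul {x y : ℕ → B} (hx : BoundedSeq x) (hy : BoundedSeq y) :
    seqClass (fun n => x n * y n) (hx.mul hy) = seqClass x hx * seqClass y hy := rfl

theorem seqClass_zero : seqClass (fun _ => (0 : B)) (BoundedSeq.const 0) = 0 := rfl

theorem seqClass_sum {ι : Type*} (s : Finset ι) {x : ι → ℕ → B} (hx : ∀ i, BoundedSeq (x i)) :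
    seqClass (fun n => ∑ i ∈ s, x i n) (BoundedSeq.sum s fun i _ => hx i) =
      ∑ i ∈ s, seqClass (x i) (hx i) := by
  classical
  induction s using Finset.induction_on with
  | empty => simp only [Finset.sum_empty, seqClass_zero]
  | insert i s hi ih =>
    simp only [Finset.sum_insert hi, ← ih]
    rfl

/-- Sequences `x` with `x* x → 0` tend to `0`. -/
theorem EqModNull.of_star_mul_self {x : ℕ → B}
    (h : EqModNull (fun n => star (x n) * x n) (fun _ => 0)) : EqModNull x (fun _ => 0) := by
  unfold EqModNull at *
  simp only [sub_zero, CStarRing.norm_star_mul_self] at h ⊢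
  simpa using h.sqrt

/-- The unit of `B^∞` given by a unitary of `B`. -/
def unitaryClass (U : B) (hU : U ∈ unitary B) : (SeqAlgebra B)ˣ where
  val := seqClass (fun _ => U) (.const U)
  inv := seqClass (fun _ => star U) (.const _)
  val_inv := by
    rw [← seqClass_mul]
    simp only [Unitary.mul_star_self_of_mem hU]
    rfl
  inv_val := by
    rw [← seqClass_mul]
    simp only [Unitary.star_mul_self_of_mem hU]
    rfl

theorem unitaryClass_pow (U : B) (hU : U ∈ unitary B) (j : ℕ) :
    ((unitaryClass U hU ^ j : (SeqAlgebra B)ˣ) : SeqAlgebra B) =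
      seqClass (fun _ => U ^ j) (.const _) := by
  induction j with
  | zero => simp only [pow_zero]; rfl
  | succ j ih =>
    rw [pow_succ, Units.val_mul, ih]
    simp only [pow_succ]
    rfl

theorem unitaryClass_pow_inv (U : B) (hU : U ∈ unitary B) (j : ℕ) :
    (((unitaryClass U hU ^ j)⁻¹ : (SeqAlgebra B)ˣ) : SeqAlgebra B) =
      seqClass (fun _ => star U ^ j) (.const _) := by
  rw [← inv_pow]
  induction j with
  | zero => simp only [pow_zero]; rfl
  | succ j ih =>
    rw [pow_succ, Units.val_mul, ih]
    simp only [pow_succ]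
    rfl

end SequenceAlgebra

/-! ### Averages of translates of a partial isometry, algebraically -/

section Averaging

variable {R : Type*} [Ring R]

/-- Turns orthogonality of translates into the form met in cross terms: `p U^d p` is `p (U^d p
U^(-d))` times a unit. Negative exponents use orthogonality on the other side. -/
theorem Units.mul_zpow_eq_zero (U : Rˣ) {p : R} {k : ℕ}
    (h₁ : ∀ j : ℕ, 1 ≤ j → j < k → p * (((U ^ j : Rˣ) : R) * p * ((U ^ j)⁻¹ : Rˣ)) = 0)
    (h₂ : ∀ j : ℕ, 1 ≤ j → j < k → (((U ^ j : Rˣ) : R) * p * ((U ^ j)⁻¹ : Rˣ)) * p = 0)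
    (d : ℤ) (hd : d ≠ 0) (hdk : |d| < k) : p * (((U ^ d : Rˣ) : R) * p) = 0 := by
  obtain ⟨j, rfl | rfl⟩ := d.eq_nat_or_neg
  · have h := h₁ j (by omega) (by simpa using hdk)
    rw [zpow_natCast]
    calc p * (((U ^ j : Rˣ) : R) * p)
        = (p * (((U ^ j : Rˣ) : R) * p * ((U ^ j)⁻¹ : Rˣ))) * ((U ^ j : Rˣ) : R) := by
          simp only [mul_assoc, Units.inv_mul, mul_one]
      _ = 0 := by rw [h, zero_mul]
  · have h := h₂ j (by omega) (by simpa using hdk)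
    rw [zpow_neg, zpow_natCast]
    calc p * (((U ^ j)⁻¹ : Rˣ) * p)
        = ((U ^ j)⁻¹ : Rˣ) * ((((U ^ j : Rˣ) : R) * p * ((U ^ j)⁻¹ : Rˣ)) * p) := by
          simp only [← mul_assoc, Units.inv_mul, one_mul]
      _ = 0 := by rw [h, mul_zero]

/-- If the translates of the projection `p ≥ w w*` are orthogonal, the sum `v` of the translates
of `w` has `v* v = k e`. -/
theorem sum_conj_mul_sum_conj (U : Rˣ) {w w' e p : R} {k : ℕ} (hww : w' * w = e)
    (hpw : p * w = w) (hwp : w' * p = w') (heU : e * U = U * e)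
    (hp : ∀ d : ℤ, d ≠ 0 → |d| < k → p * (((U ^ d : Rˣ) : R) * p) = 0) :
    (∑ i ∈ Finset.range k, ((U ^ i : Rˣ) : R) * w' * ((U ^ i)⁻¹ : Rˣ)) *
      (∑ j ∈ Finset.range k, ((U ^ j : Rˣ) : R) * w * ((U ^ j)⁻¹ : Rˣ)) = (k : R) * e := by
  have hcomm : ∀ j : ℕ, e * ((U ^ j : Rˣ) : R) = ((U ^ j : Rˣ) : R) * e := fun j => by
    have : Commute e (U : R) := heU
    rw [Units.val_pow_eq_pow_val]
    exact this.pow_right j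
  have hd : ∀ d : ℤ, d ≠ 0 → |d| < k → w' * (((U ^ d : Rˣ) : R) * w) = 0 := by
    intro d h0 hdk
    calc w' * (((U ^ d : Rˣ) : R) * w) = w' * (p * (((U ^ d : Rˣ) : R) * p)) * w := by
          nth_rewrite 1 [← hwp, ← hpw]
          simp only [mul_assoc]
      _ = 0 := by rw [hp d h0 hdk, mul_zero, zero_mul]
  rw [Finset.sum_mul]
  trans ∑ i ∈ Finset.range k, e
  · refine Finset.sum_congr rfl fun i hi => ?_
    rw [Finset.mul_sum, Finset.sum_eq_single i]
    · calc _ = ((U ^ i : Rˣ) : R) * (w' * w) * ((U ^ i)⁻¹ : Rˣ) := by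
            simp only [mul_assoc, Units.inv_mul_cancel_left]
        _ = e := by rw [hww, ← hcomm, mul_assoc, Units.mul_inv, mul_one]
    · intro j hj hij
      rw [Finset.mem_range] at hi hj
      have h := hd ((j : ℤ) - i) (by omega) (by rw [abs_lt]; constructor <;> omega)
      calc _ = ((U ^ i : Rˣ) : R) * (w' * (((U ^ ((j : ℤ) - i) : Rˣ) : R) * w)) *
            ((U ^ j)⁻¹ : Rˣ) := by
            have : (U ^ ((j : ℤ) - i) : Rˣ) = (U ^ i)⁻¹ * U ^ j := by
              rw [sub_eq_neg_add, zpow_add, zpow_neg, zpow_natCast, zpow_natCast]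
            rw [this, Units.val_mul]
            simp only [mul_assoc]
        _ = 0 := by rw [h, mul_zero, zero_mul]
    · intro h
      exact absurd hi h
  · simp

theorem mul_sum_conj (U : Rˣ) {w f : R} (k : ℕ) (hfw : f * w = w) (hfU : f * U = U * f) :
    f * (∑ j ∈ Finset.range k, ((U ^ j : Rˣ) : R) * w * ((U ^ j)⁻¹ : Rˣ)) =
      ∑ j ∈ Finset.range k, ((U ^ j : Rˣ) : R) * w * ((U ^ j)⁻¹ : Rˣ) := by
  rw [Finset.mul_sum]
  refine Finset.sum_congr rfl fun j _ => ?_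
  have hcomm : f * ((U ^ j : Rˣ) : R) = ((U ^ j : Rˣ) : R) * f := by
    have : Commute f (U : R) := hfU
    rw [Units.val_pow_eq_pow_val]
    exact this.pow_right j
  rw [← mul_assoc, ← mul_assoc, hcomm, mul_assoc _ f, hfw]

/-- No orthogonality of translates is needed: for `V` a power of `U`, `w V w = w e V w = w V e w =
0`. -/
theorem sum_conj_mul_self_eq_zero (U : Rˣ) {w e : R} (k : ℕ) (hwe : w * e = w) (hew : e * w = 0)
    (heU : e * U = U * e) :
    (∑ i ∈ Finset.range k, ((U ^ i : Rˣ) : R) * w * ((U ^ i)⁻¹ : Rˣ)) *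
      (∑ j ∈ Finset.range k, ((U ^ j : Rˣ) : R) * w * ((U ^ j)⁻¹ : Rˣ)) = 0 := by
  rw [Finset.sum_mul]
  refine Finset.sum_eq_zero fun i _ => ?_
  rw [Finset.mul_sum]
  refine Finset.sum_eq_zero fun j _ => ?_
  have hcomm : ∀ V : Rˣ, V ∈ Subgroup.zpowers U → e * (V : R) = V * e := by
    rintro V ⟨d, rfl⟩
    have : Commute e (U : R) := heU
    exact this.units_zpow_right d
  have h := hcomm ((U ^ i)⁻¹ * U ^ j) (mul_mem (inv_mem (pow_mem (Subgroup.mem_zpowers U) i))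
    (pow_mem (Subgroup.mem_zpowers U) j))
  calc _ = ((U ^ i : Rˣ) : R) * (w * (((U ^ i)⁻¹ * U ^ j : Rˣ) : R) * w) * ((U ^ j)⁻¹ : Rˣ) := by
        rw [Units.val_mul]
        simp only [mul_assoc]
    _ = 0 := by
        nth_rewrite 1 [← hwe]
        rw [mul_assoc w e, h, mul_assoc w, mul_assoc _ e w, hew, mul_zero, mul_zero, mul_zero,
          zero_mul]

/-- Conjugation by `U⁻¹` maps `S` into itself, so moving `a` past `U^j` only replaces it by another
element of `S`, with which `w` commutes. Here `S` will be the image of `A`. -/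
theorem sum_conj_mul_comm (U : Rˣ) {w : R} (k : ℕ) (S : Set R)
    (hS : ∀ a ∈ S, ∃ b ∈ S, (U : R) * b = a * U) (hw : ∀ a ∈ S, w * a = a * w) :
    ∀ a ∈ S, (∑ j ∈ Finset.range k, ((U ^ j : Rˣ) : R) * w * ((U ^ j)⁻¹ : Rˣ)) * a =
      a * ∑ j ∈ Finset.range k, ((U ^ j : Rˣ) : R) * w * ((U ^ j)⁻¹ : Rˣ) := by
  have hpow : ∀ j : ℕ, ∀ a ∈ S, ∃ b ∈ S, ((U ^ j : Rˣ) : R) * b = a * ((U ^ j : Rˣ) : R) := by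
    intro j
    induction j with
    | zero => exact fun a ha => ⟨a, ha, by simp⟩
    | succ j ih =>
      intro a ha
      obtain ⟨b, hb, hab⟩ := ih a ha
      obtain ⟨c, hc, hbc⟩ := hS b hb
      refine ⟨c, hc, ?_⟩
      rw [pow_succ, Units.val_mul, mul_assoc, hbc, ← mul_assoc, hab, mul_assoc]
  intro a ha
  rw [Finset.sum_mul, Finset.mul_sum]
  refine Finset.sum_congr rfl fun j _ => ?_
  obtain ⟨b, hb, hab⟩ := hpow j a ha
  have h : (((U ^ j)⁻¹ : Rˣ) : R) * a = b * ((U ^ j)⁻¹ : Rˣ) := by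
    rw [Units.inv_mul_eq_iff_eq_mul, ← mul_assoc, hab, mul_assoc, Units.mul_inv, mul_one]
  rw [mul_assoc, h, ← mul_assoc, mul_assoc _ w b, hw b hb, ← mul_assoc, hab]
  simp only [mul_assoc]

/-- The product is `(w e - w)* (w e - w)`. As `SeqAlgebra` carries only a ring structure, the
adjoint of `w` enters as a separate element `w'`. -/
theorem star_mul_self_sub_mul_eq_zero {w w' e : R} (h : w' * w = e) (he : e * e = e) :
    (e * w' + -w') * (w * e + -w) = 0 := by
  calc _ = e * (w' * w) * e - (w' * w) * e - e * (w' * w) + w' * w := by noncomm_ring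
    _ = 0 := by rw [h, he, he]; abel

/-- The relations satisfied by a partial isometry `w` with `w* w = e`, `w w* ≤ p f p` and
`w ^ 2 = 0`. -/
theorem partialIsometry_relations {w w' e f p : R} (hw'w : w' * w = e) (hwe : w * e = w)
    (hpp : p * p = p) (hff : f * f = f) (hfp : f * p = p * f)
    (hgw : p * f * p * (w * w') = w * w') (hww : w * w = 0) :
    p * w = w ∧ f * w = w ∧ e * w = 0 := by
  have h : p * f * p * w = w := by
    calc p * f * p * w = p * f * p * (w * w') * w := by
          rw [mul_assoc _ (w * w'), mul_assoc w, hw'w, hwe]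
      _ = w := by rw [hgw, mul_assoc, hw'w, hwe]
  refine ⟨?_, ?_, ?_⟩
  · calc p * w = p * p * f * p * w := by
          nth_rewrite 1 [← h]
          simp only [mul_assoc]
      _ = w := by rw [hpp, h]
  · calc f * w = f * p * f * p * w := by
          nth_rewrite 1 [← h]
          simp only [mul_assoc]
      _ = p * (f * f) * p * w := by rw [hfp]; simp only [mul_assoc]
      _ = w := by rw [hff, h]
  · rw [← hw'w, mul_assoc, hww, mul_zero]

end Averaging

/-! ### The normalised average of unitary translates of a sequence. -/

section Average

variable {A : Type u} [CStarAlgebra A] {B : Type v} [CStarAlgebra B]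

theorem EqModNull.map_star {x y : ℕ → B} (h : EqModNull x y) :
    EqModNull (fun n => star (x n)) (fun n => star (y n)) := by
  unfold EqModNull at *
  simpa only [← star_sub, norm_star] using h

theorem BoundedSeq.smul (c : ℂ) {x : ℕ → B} (hx : BoundedSeq x) :
    BoundedSeq (fun n => c • x n) := by
  obtain ⟨C, hC⟩ := hx
  exact ⟨‖c‖ * C, fun n => by
    rw [norm_smul]
    exact mul_le_mul_of_nonneg_left (hC n) (norm_nonneg _)⟩

theorem EqModNull.smul (c : ℂ) {x y : ℕ → B} (h : EqModNull x y) :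
    EqModNull (fun n => c • x n) (fun n => c • y n) := by
  unfold EqModNull at *
  have := h.const_mul ‖c‖
  simpa only [← smul_sub, norm_smul, mul_zero] using this

/-- In `B^∞`, if `w* w = e` is a projection then `w e = w`. -/
theorem EqModNull.mul_right_of_star_mul_self {e w : ℕ → B} (he : ∀ n, IsSelfAdjoint (e n))
    (hebd : BoundedSeq e) (hee : EqModNull (fun n => e n * e n) e) (hw : BoundedSeq w)
    (hwe : EqModNull (fun n => star (w n) * w n) e) : EqModNull (fun n => w n * e n) w := by
  have hx : EqModNull (fun n => w n * e n + -w n) (fun _ => 0) := by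
    apply EqModNull.of_star_mul_self
    have hbd : BoundedSeq (fun n => w n * e n + -w n) := (hw.mul hebd).add hw.neg
    rw [← seqClass_eq_iff (hx := hbd.star.mul hbd) (hy := .const 0)]
    have h1 : seqClass _ hw.star * seqClass w hw = seqClass e hebd :=
      seqClass_eq_iff (hx := hw.star.mul hw).2 hwe
    have h2 : seqClass e hebd * seqClass e hebd = seqClass e hebd :=
      seqClass_eq_iff (hx := hebd.mul hebd).2 hee
    have h3 : seqClass _ (hbd.star.mul hbd) =
        (seqClass e hebd * seqClass _ hw.star + -seqClass _ hw.star) *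
          (seqClass w hw * seqClass e hebd + -seqClass w hw) := by
      simp only [star_add, star_mul, star_neg, (he _).star_eq]
      rfl
    rw [h3, seqClass_zero]
    exact star_mul_self_sub_mul_eq_zero h1 h2
  unfold EqModNull at *
  simpa only [sub_zero, ← sub_eq_add_neg] using hx

/-- The normalised sum of the translates of `w` under conjugation by `U`. -/
noncomputable def conjAverage (U : B) (k : ℕ) (w : ℕ → B) (n : ℕ) : B :=
  ((Real.sqrt k)⁻¹ : ℂ) • ∑ j ∈ Finset.range k, U ^ j * w n * star U ^ j

/-- Conjugation by `U` shifts the summation index by one, so the difference telescopes and only the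
two end terms survive. -/
theorem conj_conjAverage_sub (U : B) (k : ℕ) (w : ℕ → B) (n : ℕ) :
    U * conjAverage U k w n * star U - conjAverage U k w n =
      ((Real.sqrt k)⁻¹ : ℂ) • (U ^ k * w n * star U ^ k - w n) := by
  unfold conjAverage
  rw [mul_smul_comm, smul_mul_assoc, ← smul_sub]
  congr 1
  rw [Finset.mul_sum, Finset.sum_mul]
  have : ∀ j, U * (U ^ j * w n * star U ^ j) * star U =
      U ^ (j + 1) * w n * star U ^ (j + 1) := fun j => by
    rw [pow_succ', pow_succ]
    simp only [mul_assoc]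
  simp only [this]
  rw [← Finset.sum_sub_distrib, Finset.sum_range_sub (fun j => U ^ j * w n * star U ^ j)]
  simp

theorem norm_conj_conjAverage_sub_le {U : B} (hU : U ∈ unitary B) (k : ℕ) (w : ℕ → B) (n : ℕ) :
    ‖U * conjAverage U k w n * star U - conjAverage U k w n‖ ≤
      2 * ‖w n‖ / Real.sqrt k := by
  rw [conj_conjAverage_sub, norm_smul]
  have h1 : ‖((Real.sqrt k)⁻¹ : ℂ)‖ = (Real.sqrt k)⁻¹ := by
    rw [norm_inv, Complex.norm_real, Real.norm_of_nonneg (Real.sqrt_nonneg _)]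
  have h2 : ‖U ^ k * w n * star U ^ k‖ = ‖w n‖ := by
    rw [CStarRing.norm_mul_mem_unitary _ (pow_mem (Unitary.star_mem hU) k),
      CStarRing.norm_mem_unitary_mul _ (pow_mem hU k)]
  rw [h1, div_eq_inv_mul]
  refine mul_le_mul_of_nonneg_left ?_ (by positivity)
  calc _ ≤ ‖U ^ k * w n * star U ^ k‖ + ‖w n‖ := norm_sub_le _ _
    _ = 2 * ‖w n‖ := by rw [h2]; ring

variable (φ : A →⋆ₐ[ℂ] B)

/-- The relations are checked in the ring `SeqAlgebra B` for the unnormalised sum and then read back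
on sequences. The factor `1/√k` compensates for the `k` equal diagonal terms in `v* v = k e`. -/
theorem small_isometry_conjAverage {U : B} (hU : U ∈ unitary B)
    (hcov : ∀ a : A, ∃ b : A, U * φ b = φ a * U) {k : ℕ} (hk : 0 < k) {e f p w : ℕ → B}
    (he : RepresentsCentralProjection φ e) (hf : RepresentsCentralProjection φ f)
    (heU : EqModNull (fun n => e n * U) (fun n => U * e n))
    (hfU : EqModNull (fun n => f n * U) (fun n => U * f n))
    (hpbd : BoundedSeq p) (hp : ∀ n, IsStarProjection (p n))
    (hfp : EqModNull (fun n => f n * p n) (fun n => p n * f n))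
    (hp₁ : ∀ j : ℕ, 1 ≤ j → j < k →
      EqModNull (fun n => p n * (U ^ j * p n * star U ^ j)) (fun _ => 0))
    (hp₂ : ∀ j : ℕ, 1 ≤ j → j < k →
      EqModNull (fun n => U ^ j * p n * star U ^ j * p n) (fun _ => 0))
    (hw : RepresentsRelCommutant φ w) (hwe : EqModNull (fun n => star (w n) * w n) e)
    (hfw : EqModNull (fun n => p n * f n * p n * (w n * star (w n)))
      (fun n => w n * star (w n)))
    (hww : EqModNull (fun n => w n * w n) (fun _ => 0)) :
    RepresentsRelCommutant φ (conjAverage U k w) ∧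
    EqModNull (fun n => star (conjAverage U k w n) * conjAverage U k w n) e ∧
    EqModNull (fun n => f n * (conjAverage U k w n * star (conjAverage U k w n)))
      (fun n => conjAverage U k w n * star (conjAverage U k w n)) ∧
    EqModNull (fun n => conjAverage U k w n * conjAverage U k w n) (fun _ => 0) := by
  obtain ⟨⟨hebd, -⟩, hesa, hee⟩ := he
  obtain ⟨⟨hfbd, -⟩, hfsa, hff⟩ := hf
  obtain ⟨hwbd, hwA⟩ := hw
  -- the relations in the sequence algebra
  have hWE : seqClass w hwbd * seqClass e hebd = seqClass w hwbd :=
    seqClass_eq_iff (hx := hwbd.mul hebd).2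
      (EqModNull.mul_right_of_star_mul_self hesa hebd hee hwbd hwe)
  have hW'W : seqClass _ hwbd.star * seqClass w hwbd = seqClass e hebd :=
    seqClass_eq_iff (hx := hwbd.star.mul hwbd).2 hwe
  have hPP : seqClass p hpbd * seqClass p hpbd = seqClass p hpbd := by
    rw [← seqClass_mul]
    congr 1
    ext n
    exact (hp n).isIdempotentElem
  have hFF : seqClass f hfbd * seqClass f hfbd = seqClass f hfbd :=
    seqClass_eq_iff (hx := hfbd.mul hfbd).2 hff
  have hFP : seqClass f hfbd * seqClass p hpbd = seqClass p hpbd * seqClass f hfbd :=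
    seqClass_eq_iff (hx := hfbd.mul hpbd) (hy := hpbd.mul hfbd) |>.2 hfp
  have hGW : seqClass p hpbd * seqClass f hfbd * seqClass p hpbd *
      (seqClass w hwbd * seqClass _ hwbd.star) = seqClass w hwbd * seqClass _ hwbd.star :=
    seqClass_eq_iff (hx := ((hpbd.mul hfbd).mul hpbd).mul (hwbd.mul hwbd.star))
      (hy := hwbd.mul hwbd.star) |>.2 hfw
  have hWW : seqClass w hwbd * seqClass w hwbd = 0 :=
    seqClass_eq_iff (hx := hwbd.mul hwbd) (hy := .const 0) |>.2 hww
  have hEU : seqClass e hebd * unitaryClass U hU = unitaryClass U hU * seqClass e hebd :=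
    seqClass_eq_iff (hx := hebd.mul (.const U)) (hy := (BoundedSeq.const U).mul hebd) |>.2 heU
  have hFU : seqClass f hfbd * unitaryClass U hU = unitaryClass U hU * seqClass f hfbd :=
    seqClass_eq_iff (hx := hfbd.mul (.const U)) (hy := (BoundedSeq.const U).mul hfbd) |>.2 hfU
  obtain ⟨hPW, hFW, hEW⟩ := partialIsometry_relations hW'W hWE hPP hFF hFP hGW hWW
  -- The adjoint of `p w = w`, taken on representing sequences because `SeqAlgebra` has no star.
  have hW'P : seqClass _ hwbd.star * seqClass p hpbd = seqClass _ hwbd.star := by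
    have := (seqClass_eq_iff (hx := hpbd.mul hwbd).1 hPW).map_star
    refine seqClass_eq_iff (hx := hwbd.star.mul hpbd).2 ?_
    simpa only [star_mul, (hp _).isSelfAdjoint.star_eq] using this
  -- the sum of the translates
  set u := unitaryClass U hU with hu
  have hterm : ∀ j, BoundedSeq (fun n => U ^ j * w n * star U ^ j) := fun j =>
    ((BoundedSeq.const _).mul hwbd).mul (.const _)
  have hVbd : BoundedSeq (fun n => ∑ j ∈ Finset.range k, U ^ j * w n * star U ^ j) :=
    BoundedSeq.sum _ fun j _ => hterm j
  have hVeq : seqClass _ hVbd =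
      ∑ j ∈ Finset.range k, ((u ^ j : (SeqAlgebra B)ˣ) : SeqAlgebra B) * seqClass w hwbd *
        ((u ^ j)⁻¹ : (SeqAlgebra B)ˣ) := by
    rw [seqClass_sum _ hterm]
    refine Finset.sum_congr rfl fun j _ => ?_
    rw [hu, unitaryClass_pow, unitaryClass_pow_inv]
    rfl
  have hV'eq : seqClass _ hVbd.star =
      ∑ j ∈ Finset.range k, ((u ^ j : (SeqAlgebra B)ˣ) : SeqAlgebra B) * seqClass _ hwbd.star *
        ((u ^ j)⁻¹ : (SeqAlgebra B)ˣ) := by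
    have : (fun n => star (∑ j ∈ Finset.range k, U ^ j * w n * star U ^ j)) =
        fun n => ∑ j ∈ Finset.range k, U ^ j * star (w n) * star U ^ j := by
      ext n
      rw [star_sum]
      refine Finset.sum_congr rfl fun j _ => ?_
      simp only [star_mul, star_pow, star_star, mul_assoc]
    have hterm' : ∀ j, BoundedSeq (fun n => U ^ j * star (w n) * star U ^ j) := fun j =>
      ((BoundedSeq.const _).mul hwbd.star).mul (.const _)
    simp only [this]
    rw [seqClass_sum _ hterm']
    refine Finset.sum_congr rfl fun j _ => ?_
    rw [hu, unitaryClass_pow, unitaryClass_pow_inv]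
    rfl
  have hPU : ∀ d : ℤ, d ≠ 0 → |d| < k → seqClass p hpbd *
      (((u ^ d : (SeqAlgebra B)ˣ) : SeqAlgebra B) * seqClass p hpbd) = 0 := by
    refine Units.mul_zpow_eq_zero u ?_ ?_
    · intro j h1 hjk
      rw [hu, unitaryClass_pow, unitaryClass_pow_inv, ← seqClass_mul, ← seqClass_mul,
        ← seqClass_mul, ← seqClass_zero, seqClass_eq_iff]
      exact hp₁ j h1 hjk
    · intro j h1 hjk
      rw [hu, unitaryClass_pow, unitaryClass_pow_inv, ← seqClass_mul, ← seqClass_mul,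
        ← seqClass_mul, ← seqClass_zero, seqClass_eq_iff]
      exact hp₂ j h1 hjk
  have hEsum := sum_conj_mul_sum_conj u hW'W hPW hW'P hEU hPU
  have hFsum := mul_sum_conj u k hFW hFU
  have hsq := sum_conj_mul_self_eq_zero u k hWE hEW hEU
  rw [← hVeq, ← hV'eq] at hEsum
  rw [← hVeq] at hFsum hsq
  have hcomm : ∀ a : A, seqClass _ hVbd * seqClass _ (.const (φ a)) =
      seqClass _ (.const (φ a)) * seqClass _ hVbd := by
    intro a
    have := sum_conj_mul_comm u (w := seqClass w hwbd) k
      (Set.range fun a : A => seqClass _ (.const (φ a))) ?_ ?_ _ ⟨a, rfl⟩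
    · rwa [← hVeq] at this
    · rintro _ ⟨a, rfl⟩
      obtain ⟨b, hb⟩ := hcov a
      refine ⟨_, ⟨b, rfl⟩, ?_⟩
      change seqClass _ ((BoundedSeq.const U).mul (.const (φ b))) =
        seqClass _ ((BoundedSeq.const (φ a)).mul (.const U))
      simp only [hb]
    · rintro _ ⟨a, rfl⟩
      exact seqClass_eq_iff (hx := hwbd.mul (.const (φ a)))
        (hy := (BoundedSeq.const (φ a)).mul hwbd) |>.2 (hwA a)
  -- back to sequences
  have hkc : ((Real.sqrt k)⁻¹ : ℂ) * ((Real.sqrt k)⁻¹ : ℂ) = (k : ℂ)⁻¹ := by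
    rw [← mul_inv, ← Complex.ofReal_mul, Real.mul_self_sqrt (Nat.cast_nonneg k)]
    simp
  have hstar : ∀ x : B, star (((Real.sqrt k)⁻¹ : ℂ) • x) = ((Real.sqrt k)⁻¹ : ℂ) • star x :=
    fun x => by
      rw [star_smul]
      congr 1
      simp
  refine ⟨⟨hVbd.smul _, fun a => ?_⟩, ?_, ?_, ?_⟩
  · have h := hcomm a
    rw [← seqClass_mul, ← seqClass_mul, seqClass_eq_iff] at h
    have := h.smul ((Real.sqrt k)⁻¹ : ℂ)
    simpa only [conjAverage, smul_mul_assoc, mul_smul_comm] using this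
  · have hk' : seqClass _ ((BoundedSeq.const (k : B)).mul hebd) = (k : SeqAlgebra B) *
        seqClass e hebd := rfl
    rw [← hk', ← seqClass_mul, seqClass_eq_iff] at hEsum
    have := hEsum.smul ((k : ℂ)⁻¹)
    have hke : ∀ n, ((k : ℂ)⁻¹) • ((k : B) * e n) = e n := fun n => by
      rw [← nsmul_eq_mul, ← Nat.cast_smul_eq_nsmul ℂ, smul_smul, inv_mul_cancel₀, one_smul]
      exact_mod_cast hk.ne'
    simp only [hke] at this
    simpa only [conjAverage, hstar, smul_mul_smul_comm, hkc] using this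
  · have h : seqClass _ (hfbd.mul (hVbd.mul hVbd.star)) = seqClass _ (hVbd.mul hVbd.star) := by
      rw [seqClass_mul hfbd (hVbd.mul hVbd.star), seqClass_mul hVbd hVbd.star, ← mul_assoc, hFsum]
    rw [seqClass_eq_iff] at h
    have := h.smul ((k : ℂ)⁻¹)
    simpa only [conjAverage, hstar, smul_mul_assoc, mul_smul_comm, smul_smul, hkc] using this
  · rw [← seqClass_mul, ← seqClass_zero, seqClass_eq_iff] at hsq
    have := hsq.smul ((k : ℂ)⁻¹)
    simpa only [conjAverage, smul_mul_smul_comm, hkc, smul_zero] using this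

end Average

/-! ### Asymptotic commutation is a closed condition. -/

section CommutantClosed

variable {B : Type v} [CStarAlgebra B]

theorem isClosed_setOf_eqModNull_mul_comm {x : ℕ → B} (hx : BoundedSeq x) :
    IsClosed {b : B | EqModNull (fun n => x n * b) (fun n => b * x n)} := by
  obtain ⟨C, hC⟩ := hx
  have hC0 : 0 ≤ C := (norm_nonneg _).trans (hC 0)
  rw [← isSeqClosed_iff_isClosed]
  intro b b₀ hb hlim
  simp only [Set.mem_ofPred_eq, EqModNull] at hb ⊢
  rw [Metric.tendsto_atTop]
  intro ε hε
  -- Replacing `b₀` by `b m` changes the commutator by at most `2C ‖b m - b₀‖`; the `+ 1` covers `C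
  -- = 0`.
  have hδ : 0 < ε / (2 * (2 * C + 1)) := by positivity
  obtain ⟨m, hm⟩ := ((Metric.tendsto_atTop.1 hlim) _ hδ)
  have hm := hm m le_rfl
  rw [dist_eq_norm] at hm
  obtain ⟨N, hN⟩ := (Metric.tendsto_atTop.1 (hb m)) (ε / 2) (by positivity)
  refine ⟨N, fun n hn => ?_⟩
  have h1 := hN n hn
  rw [Real.dist_eq, sub_zero, abs_of_nonneg (norm_nonneg _)] at h1 ⊢
  have h2 : x n * b₀ - b₀ * x n =
      (x n * b m - b m * x n) - (x n * (b m - b₀) - (b m - b₀) * x n) := by noncomm_ring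
  have h3 : ‖x n * (b m - b₀)‖ ≤ C * ‖b m - b₀‖ := (norm_mul_le _ _).trans
    (mul_le_mul_of_nonneg_right (hC n) (norm_nonneg _))
  have h4 : ‖(b m - b₀) * x n‖ ≤ ‖b m - b₀‖ * C := (norm_mul_le _ _).trans
    (mul_le_mul_of_nonneg_left (hC n) (norm_nonneg _))
  have h5 : 2 * C * ‖b m - b₀‖ ≤ (2 * C + 1) * (ε / (2 * (2 * C + 1))) := by
    apply mul_le_mul (by linarith) hm.le (norm_nonneg _) (by positivity)
  have h6 : (2 * C + 1) * (ε / (2 * (2 * C + 1))) = ε / 2 := by field_simp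
  rw [h2]
  have h7 := norm_sub_le (x n * b m - b m * x n) (x n * (b m - b₀) - (b m - b₀) * x n)
  have h8 := norm_sub_le (x n * (b m - b₀)) ((b m - b₀) * x n)
  linarith

end CommutantClosed

/-! ### Norms and orthogonality of projections. -/

section Projections

variable {A : Type u} [CStarAlgebra A]

theorem IsStarProjection.norm_le_one_of_cstar {p : A} (hp : IsStarProjection p) : ‖p‖ ≤ 1 := by
  have h : ‖p‖ * ‖p‖ = ‖p‖ := by
    rw [← CStarRing.norm_star_mul_self, hp.isSelfAdjoint.star_eq, hp.isIdempotentElem.eq]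
  nlinarith [norm_nonneg p, sq_nonneg (‖p‖ - 1)]

/-- Projections with sum `1` are pairwise orthogonal. -/
theorem IsStarProjection.mul_eq_zero_of_sum_eq_one {ι : Type*} {s : Finset ι} {e : ι → A}
    (he : ∀ i ∈ s, IsStarProjection (e i)) (hsum : ∑ i ∈ s, e i = 1) {i j : ι} (hi : i ∈ s)
    (hj : j ∈ s) (hij : i ≠ j) : e i * e j = 0 := by
  classical
  let := CStarAlgebra.spectralOrder A
  let := CStarAlgebra.spectralOrderedRing A
  have hterm : ∀ l ∈ s, e j * e l * e j = star (e l * e j) * (e l * e j) := fun l hl => by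
    rw [star_mul, (he l hl).isSelfAdjoint.star_eq, (he j hj).isSelfAdjoint.star_eq, mul_assoc,
      mul_assoc, ← mul_assoc (e l) (e l), (he l hl).isIdempotentElem.eq]
  -- Compress the sum by `e j`: the term `l = j` already gives `e j`, so the remaining terms, all
  -- positive, sum to zero and vanish.
  have h1 : ∑ l ∈ s, e j * e l * e j = e j := by
    rw [← Finset.sum_mul, ← Finset.mul_sum, hsum, mul_one, (he j hj).isIdempotentElem.eq]
  rw [← Finset.add_sum_erase _ _ hj, (he j hj).isIdempotentElem.eq,
    (he j hj).isIdempotentElem.eq, add_eq_left] at h1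
  have h2 := (Finset.sum_eq_zero_iff_of_nonneg (fun l hl => by
    rw [hterm l (Finset.mem_of_mem_erase hl)]
    exact star_mul_self_nonneg _)).1 h1 i (Finset.mem_erase.2 ⟨hij, hi⟩)
  rw [hterm i hi] at h2
  exact CStarRing.star_mul_self_eq_zero_iff _ |>.1 h2

end Projections

/-! ### Tracial states: norm bounds, pullbacks, and limits along central sequences. -/

namespace TracialState

variable {A : Type u} [CStarAlgebra A] (τ : TracialState A)

theorem val_add (a b : A) : τ.val (a + b) = τ.val a + τ.val b := by simp [val]

theorem val_sub (a b : A) : τ.val (a - b) = τ.val a - τ.val b := by simp [val]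

theorem val_sum {ι : Type*} (s : Finset ι) (a : ι → A) :
    τ.val (∑ i ∈ s, a i) = ∑ i ∈ s, τ.val (a i) := by simp [val]

theorem val_one : τ.val 1 = 1 := by simp [val, τ.map_one']

theorem val_star_mul_self_nonneg (a : A) : 0 ≤ τ.val (star a * a) := τ.nonneg_re' a

theorem val_nonneg_of_isStarProjection {p : A} (hp : IsStarProjection p) : 0 ≤ τ.val p := by
  have := τ.val_star_mul_self_nonneg p
  rwa [hp.isSelfAdjoint.star_eq, hp.isIdempotentElem.eq] at this

/-- `‖a‖ · 1 - a` is positive, so it is `y* y` for some `y`, and the axioms of a tracial state apply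
to it. -/
theorem selfAdjoint_bound {a : A} (ha : IsSelfAdjoint a) :
    τ.val a ≤ ‖a‖ ∧ (τ.toLinearMap a).im = 0 := by
  let := CStarAlgebra.spectralOrder A
  let := CStarAlgebra.spectralOrderedRing A
  have h := ha.le_algebraMap_norm_self
  obtain ⟨y, hy⟩ := CStarAlgebra.nonneg_iff_eq_star_mul_self.1 (sub_nonneg.2 h)
  have hre := τ.nonneg_re' y
  have him := τ.nonneg_im' y
  have halg : (algebraMap ℝ A) ‖a‖ = ((‖a‖ : ℝ) : ℂ) • (1 : A) := by
    rw [Algebra.algebraMap_eq_smul_one]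
    exact (Complex.coe_smul ‖a‖ (1 : A)).symm
  rw [← hy, halg, map_sub, map_smul, τ.map_one'] at hre him
  simp at hre him
  exact ⟨hre, him⟩

theorem abs_val_le (a : A) : |τ.val a| ≤ ‖a‖ := by
  have key : ∀ b : A, τ.val b ≤ ‖b‖ := by
    intro b
    have h1 := τ.selfAdjoint_bound (realPart b).2
    have h2 := τ.selfAdjoint_bound (imaginaryPart b).2
    have h3 : τ.val b = τ.val (realPart b : A) := by
      conv_lhs => rw [← realPart_add_I_smul_imaginaryPart b]
      rw [val_add]
      simp [val, h2.2]
    rw [h3]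
    exact h1.1.trans (realPart.norm_le b)
  rw [abs_le]
  refine ⟨?_, key a⟩
  have := key (-a)
  have h : τ.val (-a) = -τ.val a := by simp [val]
  rw [h, norm_neg] at this
  linarith

theorem norm_le (a : A) : ‖τ.toLinearMap a‖ ≤ 2 * ‖a‖ := by
  have h1 := τ.abs_val_le a
  have h2 := τ.abs_val_le (Complex.I • a)
  have h3 : τ.val (Complex.I • a) = -(τ.toLinearMap a).im := by simp [val]
  rw [h3, abs_neg, norm_smul, Complex.norm_I, one_mul] at h2
  have h4 := Complex.norm_le_abs_re_add_abs_im (τ.toLinearMap a)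
  unfold val at h1
  linarith

/-- The pullback of a tracial state along a unital ⋆-homomorphism. -/
noncomputable def comap {B : Type v} [CStarAlgebra B] (τ : TracialState B) (φ : A →⋆ₐ[ℂ] B) :
    TracialState A where
  toLinearMap := τ.toLinearMap ∘ₗ φ.toAlgHom.toLinearMap
  map_one' := by simp [τ.map_one']
  nonneg_re' a := by
    have h := τ.nonneg_re' (φ a)
    rwa [← map_star, ← map_mul] at h
  nonneg_im' a := by
    have h := τ.nonneg_im' (φ a)
    rwa [← map_star, ← map_mul] at h
  tracial' a b := by simpa using τ.tracial' (φ a) (φ b)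

theorem val_comap {B : Type v} [CStarAlgebra B] (τ : TracialState B) (φ : A →⋆ₐ[ℂ] B) (a : A) :
    (τ.comap φ).val a = τ.val (φ a) := rfl

/-- If `τ` is the only tracial state, then `τ (q pₘ) ≳ c τ q` for each central sequence `(pₘ)` of
projections of trace at least `c`. -/
theorem eventually_mul_val_sub_le (hτ : ∀ σ : TracialState A, σ = τ) {p : ℕ → A}
    (hp : ∀ m, IsStarProjection (p m))
    (hcomm : ∀ a, EqModNull (fun m => p m * a) (fun m => a * p m)) {c : ℝ} (hc : 0 < c)
    (hcp : ∀ m, c ≤ τ.val (p m)) {q : A} (hq : IsStarProjection q) {ε : ℝ} (hε : 0 < ε) :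
    ∀ᶠ m in atTop, c * τ.val q - ε ≤ τ.val (q * p m) := by
  by_contra hcon
  rw [not_eventually] at hcon
  -- An ultrafilter concentrated on the bad indices makes `τ(a pₘ)` converge for all `a` at once,
  -- with no passage to subsequences.
  set l : Filter ℕ := atTop ⊓ 𝓟 {m | ¬(c * τ.val q - ε ≤ τ.val (q * p m))} with hl
  have : NeBot l := frequently_mem_iff_neBot.1 hcon
  set G : Ultrafilter ℕ := Ultrafilter.of l
  have hG : (G : Filter ℕ) ≤ atTop := (Ultrafilter.of_le l).trans inf_le_left
  have hbad : ∀ᶠ m in (G : Filter ℕ), ¬(c * τ.val q - ε ≤ τ.val (q * p m)) :=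
    (Ultrafilter.of_le l).trans inf_le_right (mem_principal_self _)
  have hlim : ∀ a : A, ∃ z : ℂ, Tendsto (fun m => τ.toLinearMap (a * p m)) G (𝓝 z) := by
    intro a
    have hK : IsCompact (Metric.closedBall (0 : ℂ) (2 * ‖a‖)) := isCompact_closedBall _ _
    obtain ⟨z, -, hz⟩ := hK.ultrafilter_le_nhds (G.map fun m => τ.toLinearMap (a * p m)) (by
      rw [le_principal_iff]
      refine Eventually.of_forall (f := (G : Filter ℕ)) fun m => ?_
      rw [mem_closedBall_zero_iff]
      refine (τ.norm_le _).trans (mul_le_mul_of_nonneg_left ?_ zero_le_two)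
      calc ‖a * p m‖ ≤ ‖a‖ * ‖p m‖ := norm_mul_le _ _
        _ ≤ ‖a‖ * 1 := mul_le_mul_of_nonneg_left (hp m).norm_le_one_of_cstar (norm_nonneg _)
        _ = ‖a‖ := mul_one _)
    exact ⟨z, hz⟩
  choose s hs using hlim
  have hself : ∀ m, ∀ a : A, τ.toLinearMap (star a * a * p m) =
      τ.toLinearMap (star (a * p m) * (a * p m)) := by
    intro m a
    rw [star_mul, (hp m).isSelfAdjoint.star_eq, mul_assoc (p m), τ.tracial' (p m)]
    simp only [mul_assoc, (hp m).isIdempotentElem.eq]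
  have hs1re : c ≤ (s 1).re := by
    refine ge_of_tendsto ((Complex.continuous_re.tendsto _).comp (hs 1))
      (Eventually.of_forall fun m => ?_)
    simpa [val] using hcp m
  have hpos : ∀ a, 0 ≤ (s (star a * a)).re := fun a =>
    ge_of_tendsto ((Complex.continuous_re.tendsto _).comp (hs (star a * a)))
      (Eventually.of_forall fun m => by
        simp only [Function.comp_apply, hself]
        exact τ.nonneg_re' _)
  have him : ∀ a, (s (star a * a)).im = 0 := fun a => by
    refine tendsto_nhds_unique ((Complex.continuous_im.tendsto _).comp (hs (star a * a))) ?_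
    simp only [Function.comp_def, hself, τ.nonneg_im']
    exact tendsto_const_nhds
  have hs1im : (s 1).im = 0 := by simpa using him 1
  have hs1 : s 1 = ((s 1).re : ℂ) := by
    apply Complex.ext <;> simp [hs1im]
  have hs1pos : 0 < (s 1).re := hc.trans_le hs1re
  -- The normalised limit `s / s(1)`. It is positive by `τ(a* a p) = τ((a p)* (a p))` and tracial
  -- because `p` is central in the limit.
  let σ : TracialState A :=
    { toLinearMap := (((s 1).re⁻¹ : ℝ) : ℂ) •
        { toFun := s
          map_add' := fun a b => tendsto_nhds_unique (hs _) (by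
            simp only [add_mul, map_add]
            exact (hs a).add (hs b))
          map_smul' := fun z a => tendsto_nhds_unique (hs _) (by
            simp only [smul_mul_assoc, map_smul]
            exact (hs a).const_smul z) }
      map_one' := by
        change (((s 1).re⁻¹ : ℝ) : ℂ) * s 1 = 1
        rw [hs1, ← Complex.ofReal_mul, Complex.ofReal_re, inv_mul_cancel₀ hs1pos.ne']
        simp
      nonneg_re' := fun a => by
        change 0 ≤ ((((s 1).re⁻¹ : ℝ) : ℂ) * s (star a * a)).re
        rw [Complex.re_ofReal_mul]
        exact mul_nonneg (inv_nonneg.2 hs1pos.le) (hpos a)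
      nonneg_im' := fun a => by
        change ((((s 1).re⁻¹ : ℝ) : ℂ) * s (star a * a)).im = 0
        rw [Complex.im_ofReal_mul, him, mul_zero]
      tracial' := fun a b => by
        change (((s 1).re⁻¹ : ℝ) : ℂ) * s (a * b) = (((s 1).re⁻¹ : ℝ) : ℂ) * s (b * a)
        congr 1
        refine tendsto_nhds_unique (hs _) ?_
        have h0 : Tendsto (fun m => τ.toLinearMap (b * (p m * a - a * p m))) G (𝓝 0) := by
          have h := ((hcomm a).const_mul (2 * ‖b‖)).mono_left hG
          rw [mul_zero] at h
          refine squeeze_zero_norm (fun m => ?_) h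
          refine (τ.norm_le _).trans ?_
          rw [mul_assoc]
          exact mul_le_mul_of_nonneg_left (norm_mul_le _ _) zero_le_two
        have h1 := (hs (b * a)).add h0
        rw [add_zero] at h1
        refine h1.congr fun m => ?_
        rw [← map_add, mul_sub, ← mul_assoc, ← mul_assoc, add_sub_cancel, mul_assoc b,
          τ.tracial' b, mul_assoc, τ.tracial' (p m)] }
  -- Uniqueness forces `σ = τ`. With `s(1) ≥ c` this contradicts the bound on `s(q)` inherited from
  -- the bad indices.
  have hσ : (s q).re = (s 1).re * τ.val q := by
    have h : (((s 1).re⁻¹ : ℝ) : ℂ) * s q = τ.toLinearMap q := by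
      rw [← hτ σ]
      rfl
    rw [val, ← h, Complex.re_ofReal_mul, mul_inv_cancel_left₀ hs1pos.ne']
  have hle : (s q).re ≤ c * τ.val q - ε := by
    refine le_of_tendsto ((Complex.continuous_re.tendsto _).comp (hs q)) ?_
    filter_upwards [hbad] with m hm
    exact (not_le.1 hm).le
  have := mul_le_mul_of_nonneg_right hs1re (τ.val_nonneg_of_isStarProjection hq)
  linarith

end TracialState

/-! ### Bases of Rohlin towers. -/

section Rohlin

variable {A : Type u} [CStarAlgebra A] {α : A ≃⋆ₐ[ℂ] A}

theorem TracialState.val_apply_of_unique {τ : TracialState A} (hτ : ∀ σ : TracialState A, σ = τ)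
    (α : A ≃⋆ₐ[ℂ] A) (a : A) : τ.val (α a) = τ.val a := by
  have h := τ.val_comap (α : A →⋆ₐ[ℂ] A) a
  rw [hτ (τ.comap (α : A →⋆ₐ[ℂ] A))] at h
  exact h.symm

theorem norm_iterate_sub_le (α : A ≃⋆ₐ[ℂ] A) {e : ℕ → A} {k : ℕ} {δ : ℝ}
    (h : ∀ j, j + 1 < k → ‖α (e j) - e (j + 1)‖ < δ) :
    ∀ j < k, ‖α^[j] (e 0) - e j‖ ≤ j * δ := by
  intro j
  induction j with
  | zero => simp
  | succ j ih =>
    intro hj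
    have h1 := ih (by omega)
    have h2 : ‖α (α^[j] (e 0) - e j)‖ ≤ ‖α^[j] (e 0) - e j‖ :=
      NonUnitalStarAlgHom.norm_apply_le (α : A →⋆ₐ[ℂ] A) _
    rw [Function.iterate_succ_apply']
    calc ‖α (α^[j] (e 0)) - e (j + 1)‖
        = ‖α (α^[j] (e 0) - e j) + (α (e j) - e (j + 1))‖ := by rw [map_sub]; congr 1; abel
      _ ≤ ‖α (α^[j] (e 0) - e j)‖ + ‖α (e j) - e (j + 1)‖ := norm_add_le _ _
      _ ≤ j * δ + δ := add_le_add (h2.trans h1) (h j hj).le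
      _ = ((j + 1 : ℕ) : ℝ) * δ := by push_cast; ring

/-- One Rohlin tower of height at least `k` has a base of trace bounded below in terms of `k`. -/
theorem RohlinProperty.exists_base (hα : RohlinProperty α) {τ : TracialState A}
    (hτ : ∀ σ : TracialState A, σ = τ) {k : ℕ} (hk : 1 ≤ k) (F : Finset A) {ε : ℝ} (hε : 0 < ε) :
    ∃ p : A, IsStarProjection p ∧ (∀ a ∈ F, ‖a * p - p * a‖ < ε) ∧
      (∀ j, 1 ≤ j → j < k → ‖p * α^[j] p‖ ≤ ε ∧ ‖α^[j] p * p‖ ≤ ε) ∧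
      1 / (2 * (2 * k + 1)) ≤ τ.val p := by
  -- The first bound keeps the errors accumulated along a tower below `ε`; the second keeps the
  -- trace lost in descending to the base below half of `1 / (2k + 1)`.
  set δ : ℝ := min (ε / (2 * (2 * k + 1))) (1 / (2 * (2 * k + 1) * (k + 1))) with hδdef
  have hδ : 0 < δ := by positivity
  have hδ1 : δ * (2 * (2 * k + 1)) ≤ ε := by
    rw [← le_div_iff₀ (by positivity)]
    exact min_le_left _ _
  have hδ2 : (k + 1) * δ ≤ 1 / (2 * (2 * k + 1)) := by
    calc (k + 1) * δ ≤ (k + 1) * (1 / (2 * (2 * k + 1) * (k + 1))) :=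
          mul_le_mul_of_nonneg_left (min_le_right _ _) (by positivity)
      _ = 1 / (2 * (2 * k + 1)) := by field_simp
  obtain ⟨e, he, hsum, hshift, hcomm⟩ := hα k hk F δ hδ
  rw [Finset.sum_sigma'] at hsum
  set S := (Finset.range 2).sigma fun i => Finset.range (k + i) with hS
  have hmem : ∀ x ∈ S, IsStarProjection (e x.1 x.2) := fun x hx => by
    simp only [hS, Finset.mem_sigma, Finset.mem_range] at hx
    exact he _ hx.1 _ hx.2
  have hcard : S.card = 2 * k + 1 := by
    rw [hS, Finset.card_sigma]
    simp [Finset.sum_range_succ]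
    omega
  -- The `2k + 1` projections sum to `1`, so one of them has at least the average trace. Since `τ`
  -- is `α`-invariant, the base of its tower has almost the same trace.
  obtain ⟨⟨i, j⟩, hij, hle⟩ : ∃ x ∈ S, 1 / (2 * k + 1 : ℝ) ≤ τ.val (e x.1 x.2) := by
    refine Finset.exists_le_of_sum_le ?_ ?_
    · rw [← Finset.card_pos, hcard]
      omega
    · rw [← τ.val_sum, hsum, τ.val_one, Finset.sum_const, hcard, nsmul_eq_mul]
      push_cast
      rw [mul_one_div_cancel (by positivity)]
  simp only [hS, Finset.mem_sigma, Finset.mem_range] at hij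
  obtain ⟨hi, hj⟩ := hij
  have hk0 : 0 < k + i := by omega
  have hit := norm_iterate_sub_le α (hshift i hi)
  refine ⟨e i 0, he i hi 0 hk0, fun a ha => ?_, fun l hl hlk => ?_, ?_⟩
  · refine (hcomm a ha i hi 0 hk0).trans_le (le_trans ?_ hδ1)
    nlinarith [(Nat.cast_nonneg k : (0 : ℝ) ≤ k)]
  · have hlk' : l < k + i := by omega
    have h0S : (⟨i, 0⟩ : Σ _ : ℕ, ℕ) ∈ S := by simp [hS, hi]; omega
    have hlS : (⟨i, l⟩ : Σ _ : ℕ, ℕ) ∈ S := by simp [hS, hi, hlk']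
    have hne : (⟨i, 0⟩ : Σ _ : ℕ, ℕ) ≠ ⟨i, l⟩ := by
      intro h
      simp at h
      omega
    have ho1 : e i 0 * e i l = 0 :=
      IsStarProjection.mul_eq_zero_of_sum_eq_one hmem hsum h0S hlS hne
    have ho2 : e i l * e i 0 = 0 :=
      IsStarProjection.mul_eq_zero_of_sum_eq_one hmem hsum hlS h0S hne.symm
    have hb : ‖α^[l] (e i 0) - e i l‖ ≤ ε := by
      refine (hit l hlk').trans (le_trans ?_ hδ1)
      rw [mul_comm]
      refine mul_le_mul_of_nonneg_left ?_ hδ.le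
      have : (l : ℝ) ≤ k := by exact_mod_cast hlk.le
      linarith
    have hn := (he i hi 0 hk0).norm_le_one_of_cstar
    constructor
    · calc ‖e i 0 * α^[l] (e i 0)‖ = ‖e i 0 * (α^[l] (e i 0) - e i l)‖ := by
            rw [mul_sub, ho1, sub_zero]
        _ ≤ ‖e i 0‖ * ‖α^[l] (e i 0) - e i l‖ := norm_mul_le _ _
        _ ≤ 1 * ε := mul_le_mul hn hb (norm_nonneg _) zero_le_one
        _ = ε := one_mul _
    · calc ‖α^[l] (e i 0) * e i 0‖ = ‖(α^[l] (e i 0) - e i l) * e i 0‖ := by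
            rw [sub_mul, ho2, sub_zero]
        _ ≤ ‖α^[l] (e i 0) - e i l‖ * ‖e i 0‖ := norm_mul_le _ _
        _ ≤ ε * 1 := mul_le_mul hb hn (norm_nonneg _) hε.le
        _ = ε := mul_one _
  · have hinv : ∀ l : ℕ, τ.val (α^[l] (e i 0)) = τ.val (e i 0) := by
      intro l
      induction l with
      | zero => rfl
      | succ l ih => rw [Function.iterate_succ_apply', TracialState.val_apply_of_unique hτ, ih]
    have h1 := (abs_le.1 (τ.abs_val_le (α^[j] (e i 0) - e i j))).1
    rw [τ.val_sub, hinv] at h1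
    have h2 := hit j hj
    have h3 : (j : ℝ) * δ ≤ (k + 1) * δ := by
      refine mul_le_mul_of_nonneg_right ?_ hδ.le
      exact_mod_cast (by omega : j ≤ k + 1)
    have h4 : 1 / (2 * k + 1 : ℝ) = 1 / (2 * (2 * k + 1)) + 1 / (2 * (2 * k + 1)) := by
      field_simp
      norm_num
    simp only at hle
    linarith

/-- A central sequence of bases of Rohlin towers. -/
theorem RohlinProperty.exists_central_sequence [TopologicalSpace.SeparableSpace A]
    (hα : RohlinProperty α) {τ : TracialState A}
    (hτ : ∀ σ : TracialState A, σ = τ) {k : ℕ} (hk : 1 ≤ k) :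
    ∃ p : ℕ → A, (∀ m, IsStarProjection (p m)) ∧
      (∀ a, EqModNull (fun m => p m * a) (fun m => a * p m)) ∧
      (∀ j, 1 ≤ j → j < k → EqModNull (fun m => p m * α^[j] (p m)) (fun _ => 0) ∧
        EqModNull (fun m => α^[j] (p m) * p m) (fun _ => 0)) ∧
      ∃ c : ℝ, 0 < c ∧ ∀ m, c ≤ τ.val (p m) := by
  classical
  -- The `m`-th base almost commutes with the first `m + 1` terms of a dense sequence, up to `1 / (m
  -- + 1)`; closedness extends this to all of `A`.
  have hex := fun m : ℕ => hα.exists_base hτ hk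
    ((Finset.range (m + 1)).image (TopologicalSpace.denseSeq A))
    (Nat.one_div_pos_of_nat (α := ℝ) (n := m))
  choose p hp hcomm hort htr using hex
  have hbd : BoundedSeq p := ⟨1, fun m => (hp m).norm_le_one_of_cstar⟩
  refine ⟨p, hp, ?_, fun j hj hjk => ⟨?_, ?_⟩, _, by positivity, htr⟩
  · have hcl := isClosed_setOf_eqModNull_mul_comm hbd
    have hsub : Set.range (TopologicalSpace.denseSeq A) ⊆
        {b : A | EqModNull (fun n => p n * b) (fun n => b * p n)} := by
      rintro _ ⟨l, rfl⟩
      refine squeeze_zero' (Eventually.of_forall fun _ => norm_nonneg _) ?_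
        tendsto_one_div_add_atTop_nhds_zero_nat
      filter_upwards [eventually_ge_atTop l] with m hm
      rw [norm_sub_rev]
      exact (hcomm m _ (Finset.mem_image_of_mem _ (Finset.mem_range.2 (by omega)))).le
    intro a
    exact hcl.closure_subset_iff.2 hsub (TopologicalSpace.denseRange_denseSeq A a)
  · refine squeeze_zero (fun _ => norm_nonneg _) (fun m => ?_)
      (tendsto_one_div_add_atTop_nhds_zero_nat (𝕜 := ℝ))
    rw [sub_zero]
    exact (hort m j hj hjk).1
  · refine squeeze_zero (fun _ => norm_nonneg _) (fun m => ?_)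
      (tendsto_one_div_add_atTop_nhds_zero_nat (𝕜 := ℝ))
    rw [sub_zero]
    exact (hort m j hj hjk).2

end Rohlin

/-! ### Perturbing almost projections to projections. -/

section AlmostProjection

variable {A : Type u} [CStarAlgebra A]

/-- Since `|x² - x| = 1/4` at `x = 1/2`, the spectrum avoids `1/2` and the indicator of `x > 1/2` is
continuous on it. The factor 2 arises because one of `|x|`, `|x - 1|` is at least `1/2`. -/
theorem exists_isStarProjection_norm_sub_le {a : A} (ha : IsSelfAdjoint a)
    (h : ‖a * a - a‖ < 1 / 4) : ∃ r : A, IsStarProjection r ∧ ‖r - a‖ ≤ 2 * ‖a * a - a‖ := by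
  have hsq : cfc (fun x : ℝ => x * x - x) a = a * a - a := by
    rw [cfc_sub (fun x : ℝ => x * x) (fun x : ℝ => x) a, cfc_mul (fun x : ℝ => x) (fun x : ℝ => x) a,
      cfc_id' ℝ a]
  have hsp : ∀ x ∈ spectrum ℝ a, |x * x - x| ≤ ‖a * a - a‖ := fun x hx => by
    have := norm_apply_le_norm_cfc (fun x : ℝ => x * x - x) a hx
    rwa [hsq] at this
  set f : ℝ → ℝ := fun x => if 1 / 2 < x then 1 else 0 with hf
  have hfc : ContinuousOn f (spectrum ℝ a) := by
    intro x hx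
    apply ContinuousAt.continuousWithinAt
    have hne : x ≠ 1 / 2 := by
      rintro rfl
      have := (hsp _ hx).trans_lt h
      norm_num at this
    rcases lt_or_gt_of_ne hne with hlt | hgt
    · have : f =ᶠ[𝓝 x] fun _ => 0 := by
        filter_upwards [gt_mem_nhds hlt] with y hy
        simp only [hf, if_neg (not_lt.2 hy.le)]
      exact continuousAt_const.congr this.symm
    · have : f =ᶠ[𝓝 x] fun _ => 1 := by
        filter_upwards [lt_mem_nhds hgt] with y hy
        simp only [hf, if_pos hy]
      exact continuousAt_const.congr this.symm
  refine ⟨cfc f a, ⟨?_, cfc_predicate f a⟩, ?_⟩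
  · rw [IsIdempotentElem, ← cfc_mul f f a]
    congr 1
    ext x
    simp only [hf]
    split_ifs <;> simp
  · have hsub : cfc f a - a = cfc (fun x => f x - x) a := by
      rw [cfc_sub f (fun x : ℝ => x) a, cfc_id' ℝ a]
    rw [hsub]
    refine norm_cfc_le (by positivity) fun x hx => ?_
    refine le_trans ?_ (mul_le_mul_of_nonneg_left (hsp x hx) zero_le_two)
    have hfac : x * x - x = x * (x - 1) := by ring
    rw [hfac, abs_mul, Real.norm_eq_abs]
    simp only [hf]
    split_ifs with hx2
    · rw [abs_sub_comm, abs_of_pos (by linarith : 0 < x)]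
      nlinarith [abs_nonneg (x - 1)]
    · rw [zero_sub, abs_neg, abs_of_nonpos (by linarith : x - 1 ≤ 0)]
      nlinarith [abs_nonneg x]

/-- Two almost commuting projections have an approximate product that is a projection. -/
theorem IsStarProjection.exists_approx_mul {p q : A} (hp : IsStarProjection p)
    (hq : IsStarProjection q) : ∃ r : A, IsStarProjection r ∧ (‖p * q - q * p‖ < 1 / 4 →
      ‖r - q * p‖ ≤ 3 * ‖p * q - q * p‖ ∧ ‖r - p * q‖ ≤ 3 * ‖p * q - q * p‖) := by
  by_cases h : ‖p * q - q * p‖ < 1 / 4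
  · have hpn := hp.norm_le_one_of_cstar
    have hqn := hq.norm_le_one_of_cstar
    have hpp : p * p = p := hp.isIdempotentElem
    have hqq : q * q = q := hq.isIdempotentElem
    -- The compression `p q p` is self-adjoint, and its defect of idempotency is `p q [p, q] p`.
    have hsa : IsSelfAdjoint (p * q * p) := by
      rw [IsSelfAdjoint, star_mul, star_mul, hp.isSelfAdjoint.star_eq, hq.isSelfAdjoint.star_eq,
        mul_assoc]
    have h1 : p * q * p * (p * q * p) - p * q * p = p * q * ((p * q - q * p) * p) := by
      have e1 : p * q * p * (p * q * p) = p * q * (p * q) * p := by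
        simp only [← mul_assoc]
        rw [mul_assoc (p * q) p p, hpp]
      have e2 : p * q * (q * p) * p = p * q * p := by
        simp only [← mul_assoc]
        rw [mul_assoc p q q, hqq, mul_assoc (p * q) p p, hpp]
      rw [e1, sub_mul, mul_sub, ← mul_assoc (p * q) (q * p) p, e2, ← mul_assoc (p * q) (p * q) p]
    have hc : ‖(p * q - q * p) * p‖ ≤ ‖p * q - q * p‖ :=
      (norm_mul_le _ _).trans (mul_le_of_le_one_right (norm_nonneg _) hpn)
    have h2 : ‖p * q * p * (p * q * p) - p * q * p‖ ≤ ‖p * q - q * p‖ := by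
      rw [h1]
      refine (norm_mul_le _ _).trans ((mul_le_of_le_one_left (norm_nonneg _) ?_).trans hc)
      exact (norm_mul_le _ _).trans (mul_le_one₀ hpn (norm_nonneg _) hqn)
    obtain ⟨r, hr, hrn⟩ := exists_isStarProjection_norm_sub_le hsa (h2.trans_lt h)
    refine ⟨r, hr, fun _ => ⟨?_, ?_⟩⟩
    · have e : r - q * p = (r - p * q * p) + (p * q - q * p) * p := by
        rw [sub_mul, mul_assoc q p p, hpp]
        abel
      rw [e]
      refine (norm_add_le _ _).trans ?_
      linarith
    · have e : r - p * q = (r - p * q * p) - p * (p * q - q * p) := by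
        rw [mul_sub, ← mul_assoc p p q, hpp, ← mul_assoc]
        abel
      have hc' : ‖p * (p * q - q * p)‖ ≤ ‖p * q - q * p‖ :=
        (norm_mul_le _ _).trans (mul_le_of_le_one_left (norm_nonneg _) hpn)
      rw [e]
      refine (norm_sub_le _ _).trans ?_
      linarith
  · exact ⟨p, hp, fun h' => absurd h' h⟩

end AlmostProjection

/-- Diagonal sequences. -/
theorem exists_diagonal {Q : ℕ → ℕ → Prop} (h : ∀ m, ∀ᶠ n in atTop, Q m n) :
    ∃ μ : ℕ → ℕ, Tendsto μ atTop atTop ∧ ∀ᶠ n in atTop, Q (μ n) n := by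
  classical
  simp only [eventually_atTop] at h
  have hN : ∀ m, ∃ N, ∀ n, N ≤ n → ∀ n', n ≤ n' → Q m n' := fun m => by
    obtain ⟨N, hN⟩ := h m
    exact ⟨N, fun n hn n' hn' => hN n' (hn.trans hn')⟩
  choose N hN using hN
  -- Take the largest `m ≤ n` for which `Q m` holds from `n` on. The default value `0` of
  -- `Nat.findGreatest` is harmless once `n ≥ N 0`.
  refine ⟨fun n => Nat.findGreatest (fun m => ∀ n', n ≤ n' → Q m n') n, ?_, ?_⟩
  · rw [tendsto_atTop]
    intro m
    filter_upwards [eventually_ge_atTop (max m (N m))] with n hn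
    exact Nat.le_findGreatest ((le_max_left _ _).trans hn) (hN m n ((le_max_right _ _).trans hn))
  · filter_upwards [eventually_ge_atTop (N 0)] with n hn
    exact Nat.findGreatest_spec (P := fun m => ∀ n', n ≤ n' → Q m n') (Nat.zero_le n)
      (hN 0 n hn) n le_rfl

/-! ### Cutting `f` by a central sequence of projections of `A`. -/

section Cut

variable {A : Type u} [CStarAlgebra A] {B : Type v} [CStarAlgebra B] {φ : A →⋆ₐ[ℂ] B}

theorem EqModNull.comp {x y : ℕ → B} (h : EqModNull x y) {μ : ℕ → ℕ}
    (hμ : Tendsto μ atTop atTop) : EqModNull (fun n => x (μ n)) (fun n => y (μ n)) :=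
  Tendsto.comp (g := fun n => ‖x n - y n‖) h hμ

theorem EqModNull.map {x y : ℕ → A} (h : EqModNull x y) (φ : A →⋆ₐ[ℂ] B) :
    EqModNull (fun n => φ (x n)) (fun n => φ (y n)) := by
  refine squeeze_zero (fun _ => norm_nonneg _) (fun n => ?_) h
  rw [← map_sub]
  exact NonUnitalStarAlgHom.norm_apply_le φ _

theorem IsStarProjection.map_starAlgHom {p : A} (hp : IsStarProjection p) (φ : A →⋆ₐ[ℂ] B) :
    IsStarProjection (φ p) :=
  ⟨by rw [IsIdempotentElem, ← map_mul, hp.isIdempotentElem.eq],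
    by rw [IsSelfAdjoint, ← map_star, hp.isSelfAdjoint.star_eq]⟩

/-- In `B^∞` the cut is the product of two commuting projections; the symmetric form `P f P` makes
every term self-adjoint. -/
theorem representsCentralProjection_cut {f P : ℕ → B} (hf : RepresentsCentralProjection φ f)
    (hP : ∀ n, IsStarProjection (P n))
    (hPc : ∀ a, EqModNull (fun n => P n * φ a) (fun n => φ a * P n))
    (hfP : EqModNull (fun n => f n * P n) (fun n => P n * f n)) :
    RepresentsCentralProjection φ (fun n => P n * f n * P n) := by
  obtain ⟨⟨hfbd, hfc⟩, hfsa, hff⟩ := hf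
  have hPbd : BoundedSeq P := ⟨1, fun n => (hP n).norm_le_one_of_cstar⟩
  have hgbd := (hPbd.mul hfbd).mul hPbd
  have hPP : seqClass P hPbd * seqClass P hPbd = seqClass P hPbd := by
    rw [← seqClass_mul]
    congr 1
    ext n
    exact (hP n).isIdempotentElem
  have hFF : seqClass f hfbd * seqClass f hfbd = seqClass f hfbd :=
    seqClass_eq_iff (hx := hfbd.mul hfbd).2 hff
  have hFP : seqClass f hfbd * seqClass P hPbd = seqClass P hPbd * seqClass f hfbd :=
    seqClass_eq_iff (hx := hfbd.mul hPbd) (hy := hPbd.mul hfbd) |>.2 hfP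
  have hG : seqClass _ hgbd = seqClass P hPbd * seqClass f hfbd := by
    rw [seqClass_mul (hPbd.mul hfbd) hPbd, seqClass_mul hPbd hfbd, mul_assoc, hFP, ← mul_assoc, hPP]
  refine ⟨⟨hgbd, fun a => ?_⟩, fun n => ?_, ?_⟩
  · have h1 : seqClass f hfbd * seqClass _ (.const (φ a)) =
        seqClass _ (.const (φ a)) * seqClass f hfbd :=
      seqClass_eq_iff (hx := hfbd.mul (.const _)) (hy := (BoundedSeq.const _).mul hfbd) |>.2 (hfc a)
    have h2 : seqClass P hPbd * seqClass _ (.const (φ a)) =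
        seqClass _ (.const (φ a)) * seqClass P hPbd :=
      seqClass_eq_iff (hx := hPbd.mul (.const _)) (hy := (BoundedSeq.const _).mul hPbd) |>.2 (hPc a)
    refine seqClass_eq_iff (hx := hgbd.mul (.const _)) (hy := (BoundedSeq.const _).mul hgbd) |>.1 ?_
    rw [seqClass_mul hgbd (.const _), seqClass_mul (.const _) hgbd, hG, mul_assoc, h1, ← mul_assoc,
      h2, mul_assoc]
  · rw [IsSelfAdjoint, star_mul, star_mul, (hP n).isSelfAdjoint.star_eq, (hfsa n).star_eq,
      ← mul_assoc]
  · refine seqClass_eq_iff (hx := hgbd.mul hgbd) (hy := hgbd) |>.1 ?_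
    rw [seqClass_mul hgbd hgbd, hG]
    calc _ = seqClass P hPbd * (seqClass f hfbd * seqClass P hPbd) * seqClass f hfbd := by
          simp only [mul_assoc]
      _ = seqClass P hPbd * seqClass P hPbd * (seqClass f hfbd * seqClass f hfbd) := by
          rw [hFP]
          simp only [mul_assoc]
      _ = _ := by rw [hPP, hFF]

theorem norm_conj_sub_conj_le {x x' y y' z : B} {C : ℝ} (hz : ‖z‖ ≤ C) (hy : ‖y‖ ≤ 1)
    (hx' : ‖x'‖ ≤ 1) : ‖x * z * y - x' * z * y'‖ ≤ C * ‖x - x'‖ + C * ‖y - y'‖ := by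
  have hC : 0 ≤ C := (norm_nonneg _).trans hz
  have e : x * z * y - x' * z * y' = (x - x') * z * y + x' * z * (y - y') := by noncomm_ring
  rw [e]
  refine (norm_add_le _ _).trans (add_le_add ?_ ?_)
  · calc ‖(x - x') * z * y‖ ≤ ‖x - x'‖ * ‖z‖ * ‖y‖ := norm_mul₃_le
      _ ≤ ‖x - x'‖ * C * 1 := by gcongr
      _ = C * ‖x - x'‖ := by ring
  · calc ‖x' * z * (y - y')‖ ≤ ‖x'‖ * ‖z‖ * ‖y - y'‖ := norm_mul₃_le
      _ ≤ 1 * C * ‖y - y'‖ := by gcongr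
      _ = C * ‖y - y'‖ := by ring

/-- A central projection `f` that is bounded below in trace can be cut by a slowed-down central
sequence of projections of `A` of trace at least `c`. -/
theorem exists_traceBoundedBelow_cut [TopologicalSpace.SeparableSpace A] {τ : TracialState A}
    (hτ : ∀ σ : TracialState A, σ = τ) {f : ℕ → B} (hf : RepresentsCentralProjection φ f)
    (hft : TraceBoundedBelow φ f) {p : ℕ → A} (hp : ∀ m, IsStarProjection (p m))
    (hpc : ∀ a, EqModNull (fun m => p m * a) (fun m => a * p m)) {c : ℝ} (hc : 0 < c)
    (hcp : ∀ m, c ≤ τ.val (p m)) :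
    ∃ μ : ℕ → ℕ, Tendsto μ atTop atTop ∧
      EqModNull (fun n => f n * φ (p (μ n))) (fun n => φ (p (μ n)) * f n) ∧
      TraceBoundedBelow φ (fun n => φ (p (μ n)) * f n * φ (p (μ n))) := by
  classical
  obtain ⟨c₀, hc₀, hft⟩ := hft
  obtain ⟨C, hC⟩ := hf.1.1
  have hC0 : 0 ≤ C := (norm_nonneg _).trans (hC 0)
  have : Nonempty {q : A // IsStarProjection q} := ⟨⟨p 0, hp 0⟩⟩
  have : SecondCountableTopology A := UniformSpace.secondCountable_of_separable A
  set q := TopologicalSpace.denseSeq {q : A // IsStarProjection q} with hq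
  -- Condition (1) for `f` speaks of projections only, so each product `q l * p m` is replaced by a
  -- nearby projection `r m l`.
  have hr := fun m l => (hp m).exists_approx_mul (q l).2
  choose r hr hrn using hr
  -- For fixed `m` only the finitely many projections `r m l`, `l ≤ m`, are tested, so a single
  -- threshold in `n` suffices; `μ` passes to the next `m` only after it.
  have hdiag : ∀ m, ∀ᶠ n in atTop, ‖f n * φ (p m) - φ (p m) * f n‖ < 1 / (m + 1 : ℝ) ∧
      ∀ l ∈ Set.Iic m, ∀ σ : TracialState B,
        c₀ * σ.val (φ (r m l)) - 1 / (m + 1 : ℝ) ≤ σ.val (φ (r m l) * f n * φ (r m l)) := by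
    intro m
    refine Eventually.and ?_ ((eventually_all_finite (Set.finite_Iic m)).2 fun l _ => ?_)
    · exact (hf.1.2 (p m)).eventually_lt_const Nat.one_div_pos_of_nat
    · exact eventually_atTop.2 (hft (r m l) (hr m l) _ Nat.one_div_pos_of_nat)
  obtain ⟨μ, hμ, hQ⟩ := exists_diagonal hdiag
  refine ⟨μ, hμ, ?_, c₀ * c, mul_pos hc₀ hc, fun q₀ hq₀ ε hε => ?_⟩
  · exact squeeze_zero' (Eventually.of_forall fun _ => norm_nonneg _) (hQ.mono fun n hn => hn.1.le)
      ((tendsto_one_div_add_atTop_nhds_zero_nat (𝕜 := ℝ)).comp hμ)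
  -- Total error: `2Cδ` for `q₀ ≈ q l`, `6Cδ` for `R` against `q l * P` on both sides of `f`, `δ`
  -- from condition (1), `4c₀δ` for the trace of `R`, and `c₀cδ` for that of `q l`.
  set δ := ε / (8 * C + 1 + 4 * c₀ + c₀ * c) with hδdef
  have hK : 0 < 8 * C + 1 + 4 * c₀ + c₀ * c := by positivity
  have hδ : 0 < δ := div_pos hε hK
  have hδε : (8 * C + 1 + 4 * c₀ + c₀ * c) * δ = ε := mul_div_cancel₀ _ hK.ne'
  obtain ⟨l, hl⟩ : ∃ l, ‖q₀ - (q l : A)‖ < δ := by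
    obtain ⟨l, hl⟩ := (TopologicalSpace.denseRange_denseSeq
      {q : A // IsStarProjection q}).exists_dist_lt ⟨q₀, hq₀⟩ hδ
    exact ⟨l, by rwa [Subtype.dist_eq, dist_eq_norm] at hl⟩
  have hd : Tendsto (fun n => ‖p (μ n) * (q l : A) - q l * p (μ n)‖) atTop (𝓝 0) :=
    (hpc (q l)).comp hμ
  have ev := hQ.and ((hd.eventually_lt_const hδ).and ((hd.eventually_lt_const
    (by norm_num : (0 : ℝ) < 1 / 4)).and ((hμ.eventually_ge_atTop l).and
    ((((tendsto_one_div_add_atTop_nhds_zero_nat (𝕜 := ℝ)).comp hμ).eventually_lt_const hδ).and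
    (hμ.eventually (τ.eventually_mul_val_sub_le hτ hp hpc hc hcp (q l).2 hδ))))))
  obtain ⟨N, hN⟩ := eventually_atTop.1 ev
  refine ⟨N, fun n hn σ => ?_⟩
  obtain ⟨⟨-, h1⟩, h2, h3, h4, h5, h6⟩ := hN n hn
  simp only [Function.comp_apply] at h5
  have hσ : ∀ a : A, σ.val (φ a) = τ.val a := fun a => by
    rw [← σ.val_comap φ, hτ (σ.comap φ)]
  have h1 := h1 l h4 σ
  obtain ⟨hr1, hr2⟩ := hrn (μ n) l h3
  set R := r (μ n) l
  set P := p (μ n)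
  have hPn : ‖φ P‖ ≤ 1 := ((hp (μ n)).map_starAlgHom φ).norm_le_one_of_cstar
  have hqn : ∀ {x : A}, IsStarProjection x → ‖φ x‖ ≤ 1 := fun hx =>
    (hx.map_starAlgHom φ).norm_le_one_of_cstar
  have hPq : ‖φ (q l) * φ P‖ ≤ 1 := (norm_mul_le _ _).trans
    (mul_le_one₀ (hqn (q l).2) (norm_nonneg _) hPn)
  have hφ : ∀ x y : A, ‖φ x - φ y‖ ≤ ‖x - y‖ := fun x y => by
    rw [← map_sub]
    exact NonUnitalStarAlgHom.norm_apply_le φ _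
  have hgn : ‖φ P * f n * φ P‖ ≤ C := by
    calc ‖φ P * f n * φ P‖ ≤ ‖φ P‖ * ‖f n‖ * ‖φ P‖ := norm_mul₃_le
      _ ≤ 1 * C * 1 := by gcongr; exact hC n
      _ = C := by ring
  have e1 := (abs_le.1 (σ.abs_val_le
    (φ q₀ * (φ P * f n * φ P) * φ q₀ - φ (q l) * (φ P * f n * φ P) * φ (q l)))).1
  have e2 := norm_conj_sub_conj_le (x := φ q₀) (y' := φ (q l)) hgn (hqn hq₀) (hqn (q l).2)
  have e3 := (abs_le.1 (σ.abs_val_le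
    (φ R * f n * φ R - φ (q l) * φ P * f n * (φ P * φ (q l))))).2
  have e4 := norm_conj_sub_conj_le (x := φ R) (y' := φ P * φ (q l)) (hC n) (hqn (hr (μ n) l)) hPq
  have e5 := hφ R (q l * P)
  have e6 := hφ R (P * q l)
  rw [map_mul] at e5 e6
  have e7 : φ (q l) * (φ P * f n * φ P) * φ (q l) = φ (q l) * φ P * f n * (φ P * φ (q l)) := by
    simp only [mul_assoc]
  rw [σ.val_sub, e7] at e1
  rw [e7] at e2
  rw [σ.val_sub] at e3
  have e8 := (abs_le.1 (τ.abs_val_le (R - q l * P))).1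
  rw [τ.val_sub] at e8
  have e9 := (abs_le.1 (τ.abs_val_le (q₀ - q l))).2
  rw [τ.val_sub] at e9
  have e10 := hφ q₀ (q l)
  rw [hσ] at h1 ⊢
  have m1 : C * ‖φ q₀ - φ (q l)‖ ≤ C * δ := mul_le_mul_of_nonneg_left (e10.trans hl.le) hC0
  have m2 : C * ‖φ R - φ (q l) * φ P‖ ≤ C * (3 * δ) :=
    mul_le_mul_of_nonneg_left (by linarith) hC0
  have m3 : C * ‖φ R - φ P * φ (q l)‖ ≤ C * (3 * δ) :=
    mul_le_mul_of_nonneg_left (by linarith) hC0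
  have m4 : c * (τ.val q₀ - δ) ≤ c * τ.val (q l) := mul_le_mul_of_nonneg_left (by linarith) hc.le
  have m5 : c₀ * (c * (τ.val q₀ - δ) - δ - 3 * δ) ≤ c₀ * τ.val R :=
    mul_le_mul_of_nonneg_left (by linarith) hc₀.le
  linarith

end Cut

/-! ### From almost invariant to invariant small isometries. -/

section Invariant

variable {A : Type u} [CStarAlgebra A] {B : Type v} [CStarAlgebra B] {φ : A →⋆ₐ[ℂ] B}

theorem conj_pow_eq_map_iterate {α : A ≃⋆ₐ[ℂ] A} {U : B}
    (hcov : ∀ a, U * φ a * star U = φ (α a)) (j : ℕ) (a : A) :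
    U ^ j * φ a * star U ^ j = φ (α^[j] a) := by
  induction j with
  | zero => simp
  | succ j ih =>
    rw [Function.iterate_succ_apply', ← hcov, ← ih, pow_succ', pow_succ]
    simp only [mul_assoc]

theorem norm_sq_le_of_star_mul_self {x e : B} {C : ℝ} (he : ‖e‖ ≤ C)
    (h : ‖star x * x - e‖ ≤ 1) : ‖x‖ ≤ Real.sqrt (C + 1) := by
  apply Real.le_sqrt_of_sq_le
  have h1 : ‖star x * x‖ ≤ ‖star x * x - e‖ + ‖e‖ := by
    simpa using norm_add_le (star x * x - e) e
  rw [CStarRing.norm_star_mul_self] at h1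
  nlinarith

/-- `H` is (SI) of `A` with `e` fixed, which hides the version of condition (2) in use. The last
bound holds only eventually, since `‖w n‖` is controlled through `w* w ≈ e`. -/
theorem exists_almost_invariant_smallIsometry [TopologicalSpace.SeparableSpace A]
    {τ : TracialState A} (hτ : ∀ σ : TracialState A, σ = τ) {α : A ≃⋆ₐ[ℂ] A}
    (hα : RohlinProperty α) {U : B} (hU : U ∈ unitary B)
    (hcov : ∀ a, U * φ a * star U = φ (α a)) {e f : ℕ → B}
    (he : RepresentsCentralProjection φ e) (hf : RepresentsCentralProjection φ f)
    (heU : EqModNull (fun n => e n * U) (fun n => U * e n))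
    (hfU : EqModNull (fun n => f n * U) (fun n => U * f n)) (hft : TraceBoundedBelow φ f)
    (H : ∀ g : ℕ → B, RepresentsCentralProjection φ g → TraceBoundedBelow φ g →
      SmallIsometryExists φ e g) {C : ℝ} (hC : ∀ n, ‖e n‖ ≤ C) {k : ℕ} (hk : 1 ≤ k) :
    ∃ v : ℕ → B, RepresentsRelCommutant φ v ∧
      EqModNull (fun n => star (v n) * v n) e ∧
      EqModNull (fun n => f n * (v n * star (v n))) (fun n => v n * star (v n)) ∧
      EqModNull (fun n => v n * v n) (fun _ => 0) ∧
      ∀ᶠ n in atTop, ‖U * v n * star U - v n‖ ≤ 2 * Real.sqrt (C + 1) / Real.sqrt k := by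
  obtain ⟨p, hp, hpc, hport, c, hc, hcp⟩ := hα.exists_central_sequence hτ hk
  obtain ⟨μ, hμ, hfp, hgt⟩ := exists_traceBoundedBelow_cut hτ hf hft hp hpc hc hcp
  have hP : ∀ n, IsStarProjection (φ (p (μ n))) := fun n => (hp (μ n)).map_starAlgHom φ
  have hPc : ∀ a, EqModNull (fun n => φ (p (μ n)) * φ a) (fun n => φ a * φ (p (μ n))) := by
    intro a
    have := ((hpc a).comp hμ).map φ
    simpa only [map_mul] using this
  obtain ⟨w, hw, hwe, hfw, hww⟩ := H _ (representsCentralProjection_cut hf hP hPc hfp) hgt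
  have hcov' : ∀ a : A, ∃ b : A, U * φ b = φ a * U := fun a => ⟨α.symm a, by
    have h := hcov (α.symm a)
    rw [StarAlgEquiv.apply_symm_apply] at h
    rw [← h, mul_assoc _ (star U), Unitary.star_mul_self_of_mem hU, mul_one]⟩
  have hPbd : BoundedSeq fun n => φ (p (μ n)) := ⟨1, fun n => (hP n).norm_le_one_of_cstar⟩
  obtain ⟨h1, h2, h3, h4⟩ := small_isometry_conjAverage φ hU hcov' hk he hf heU hfU hPbd hP hfp
    (fun j hj hjk => by
      have := ((hport j hj hjk).1.comp hμ).map φ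
      simpa only [map_mul, map_zero, conj_pow_eq_map_iterate hcov] using this)
    (fun j hj hjk => by
      have := ((hport j hj hjk).2.comp hμ).map φ
      simpa only [map_mul, map_zero, conj_pow_eq_map_iterate hcov] using this) hw hwe hfw hww
  refine ⟨_, h1, h2, h3, h4, ?_⟩
  filter_upwards [hwe.eventually_lt_const zero_lt_one] with n hn
  refine (norm_conj_conjAverage_sub_le hU k w n).trans ?_
  gcongr
  exact norm_sq_le_of_star_mul_self (hC n) hn.le

/-- The averages for growing `k` have invariance defect `O(k^(-1/2))` and are uniformly bounded, so
a diagonal sequence of them commutes with `U` in the limit. -/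
theorem exists_invariant_smallIsometry [TopologicalSpace.SeparableSpace A]
    {τ : TracialState A} (hτ : ∀ σ : TracialState A, σ = τ) {α : A ≃⋆ₐ[ℂ] A}
    (hα : RohlinProperty α) {U : B} (hU : U ∈ unitary B)
    (hcov : ∀ a, U * φ a * star U = φ (α a)) {e f : ℕ → B}
    (he : RepresentsCentralProjection φ e) (hf : RepresentsCentralProjection φ f)
    (heU : EqModNull (fun n => e n * U) (fun n => U * e n))
    (hfU : EqModNull (fun n => f n * U) (fun n => U * f n)) (hft : TraceBoundedBelow φ f)
    (H : ∀ g : ℕ → B, RepresentsCentralProjection φ g → TraceBoundedBelow φ g →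
      SmallIsometryExists φ e g) :
    ∃ w : ℕ → B, RepresentsRelCommutant φ w ∧ EqModNull (fun n => w n * U) (fun n => U * w n) ∧
      EqModNull (fun n => star (w n) * w n) e ∧
      EqModNull (fun n => f n * (w n * star (w n))) (fun n => w n * star (w n)) ∧
      EqModNull (fun n => w n * w n) (fun _ => 0) := by
  classical
  obtain ⟨C, hC⟩ := he.1.1
  have : Nonempty A := ⟨0⟩
  set a := TopologicalSpace.denseSeq A
  let Good : ℕ → ℕ → B → Prop := fun k n x =>
    (∀ l ∈ Set.Iic k, ‖x * φ (a l) - φ (a l) * x‖ < 1 / (k + 1 : ℝ)) ∧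
    ‖star x * x - e n‖ < 1 / (k + 1 : ℝ) ∧
    ‖f n * (x * star x) - x * star x‖ < 1 / (k + 1 : ℝ) ∧
    ‖x * x - 0‖ < 1 / (k + 1 : ℝ) ∧
    ‖U * x * star U - x‖ ≤ 2 * Real.sqrt (C + 1) / Real.sqrt (k + 1 : ℕ)
  have hgood : ∀ k, ∀ᶠ n in atTop, ∃ x, Good k n x := by
    intro k
    obtain ⟨v, h1, h2, h3, h4, h5⟩ := exists_almost_invariant_smallIsometry hτ hα hU hcov he hf heU
      hfU hft H hC (Nat.le_add_left 1 k)
    have hpos : (0 : ℝ) < 1 / (k + 1 : ℝ) := Nat.one_div_pos_of_nat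
    have h1' : ∀ᶠ n in atTop, ∀ l ∈ Set.Iic k, ‖v n * φ (a l) - φ (a l) * v n‖ < 1 / (k + 1 : ℝ) :=
      (eventually_all_finite (Set.finite_Iic k)).2 fun l _ =>
        (h1.2 (a l)).eventually_lt_const hpos
    filter_upwards [h1', h2.eventually_lt_const hpos, h3.eventually_lt_const hpos,
      h4.eventually_lt_const hpos, h5] with n g1 g2 g3 g4 g5
    exact ⟨v n, g1, g2, g3, g4, g5⟩
  obtain ⟨μ, hμ, hev⟩ := exists_diagonal hgood
  -- The default `0` at the finitely many `n` that may lack a good element keeps the whole sequence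
  -- bounded.
  have hchoice : ∀ n, ∃ x, (Good (μ n) n x ∨ x = 0) ∧ ((∃ y, Good (μ n) n y) → Good (μ n) n x) := by
    intro n
    by_cases h : ∃ y, Good (μ n) n y
    · obtain ⟨y, hy⟩ := h
      exact ⟨y, Or.inl hy, fun _ => hy⟩
    · exact ⟨0, Or.inr rfl, fun h' => absurd h' h⟩
  choose w hw0 hw using hchoice
  have hwev : ∀ᶠ n in atTop, Good (μ n) n (w n) := hev.mono fun n hn => hw n hn
  have hlim := (tendsto_one_div_add_atTop_nhds_zero_nat (𝕜 := ℝ)).comp hμ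
  have hnull : ∀ {x y : ℕ → B}, (∀ᶠ n in atTop, ‖x n - y n‖ < 1 / ((μ n : ℝ) + 1)) →
      EqModNull x y := fun h =>
    squeeze_zero' (Eventually.of_forall fun _ => norm_nonneg _) (h.mono fun n hn => hn.le) hlim
  have hbd : BoundedSeq w := by
    refine ⟨Real.sqrt (C + 1), fun n => ?_⟩
    rcases hw0 n with h | h
    · refine norm_sq_le_of_star_mul_self (hC n) (h.2.1.le.trans ?_)
      rw [div_le_one (by positivity)]
      linarith [(Nat.cast_nonneg (μ n) : (0 : ℝ) ≤ μ n)]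
    · rw [h, norm_zero]
      exact Real.sqrt_nonneg _
  refine ⟨w, ⟨hbd, fun b => ?_⟩, ?_, hnull (hwev.mono fun n hn => hn.2.1),
    hnull (hwev.mono fun n hn => hn.2.2.1), hnull (hwev.mono fun n hn => hn.2.2.2.1)⟩
  · have hcl := (isClosed_setOf_eqModNull_mul_comm hbd).preimage
      (f := φ) (AddMonoidHomClass.continuous_of_bound φ 1
        fun x => by simpa using NonUnitalStarAlgHom.norm_apply_le φ x)
    have hsub : Set.range a ⊆
        φ ⁻¹' {b : B | EqModNull (fun n => w n * b) (fun n => b * w n)} := by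
      rintro _ ⟨l, rfl⟩
      refine hnull ?_
      filter_upwards [hwev, hμ.eventually_ge_atTop l] with n hn hl
      exact hn.1 l hl
    exact hcl.closure_subset_iff.2 hsub (TopologicalSpace.denseRange_denseSeq A b)
  · have hlim' : Tendsto (fun n => 2 * Real.sqrt (C + 1) / Real.sqrt (μ n + 1 : ℕ)) atTop (𝓝 0) := by
      refine Tendsto.const_div_atTop ?_ _
      exact Real.tendsto_sqrt_atTop.comp (tendsto_natCast_atTop_atTop.comp
        ((tendsto_add_atTop_nat 1).comp hμ))
    refine squeeze_zero' (Eventually.of_forall fun _ => norm_nonneg _) ?_ hlim'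
    filter_upwards [hwev] with n hn
    refine le_trans (le_of_eq ?_) hn.2.2.2.2
    have h : (U * w n * star U - w n) * U = U * w n - w n * U := by
      rw [sub_mul, mul_assoc _ (star U), Unitary.star_mul_self_of_mem hU, mul_one]
    rw [norm_sub_rev, ← h, CStarRing.norm_mul_mem_unitary _ hU]

end Invariant

/-! ### GNS and regular representations: covariant representations separate points of `A`. -/

section RegularRepresentation

open scoped ComplexOrder in
/-- Positive functionals separate the points of a C⋆-algebra. -/
theorem exists_positiveLinearMap_ne_zero {A : Type u} [CStarAlgebra A] [PartialOrder A] [StarOrderedRing A] {a : A} (ha : a ≠ 0) :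
    ∃ f : A →ₚ[ℂ] ℂ, f (star a * a) ≠ 0 := by
  have hmem : -(star a * a) ∉ ProperCone.positive ℝ A := by
    intro h
    rw [ProperCone.mem_positive] at h
    have h1 : star a * a = 0 := le_antisymm (neg_nonneg.1 h) (star_mul_self_nonneg a)
    exact ha ((CStarRing.star_mul_self_eq_zero_iff a).1 h1)
  obtain ⟨g, hg, hga⟩ := ProperCone.hyperplane_separation_point _ hmem
  let f₀ : A →ₗ[ℂ] ℂ := Module.Dual.extendRCLike (𝕜 := ℂ) (g : A →ₗ[ℝ] ℝ)
  have hre : ∀ x, (f₀ x).re = g x := fun x => by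
    simp [f₀, Module.Dual.extendRCLike_apply]
  -- `f₀` may take non-real values on self-adjoint elements; its hermitian part is real there and
  -- still agrees with `g` on positive ones.
  let f : A →ₗ[ℂ] ℂ :=
    { toFun := fun x => (f₀ x + starRingEnd ℂ (f₀ (star x))) / 2
      map_add' := fun x y => by
        simp only [star_add, map_add]
        ring
      map_smul' := fun z x => by
        simp only [star_smul, map_smul, smul_eq_mul, map_mul, RingHom.id_apply, starRingEnd_apply,
          star_star]
        ring }
  have hf : ∀ x : A, 0 ≤ x → f x = (g x : ℂ) := fun x hx => by
    have h : f x = (f₀ x + starRingEnd ℂ (f₀ x)) / 2 := by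
      change (f₀ x + starRingEnd ℂ (f₀ (star x))) / 2 = _
      rw [(IsSelfAdjoint.of_nonneg hx).star_eq]
    rw [h, Complex.add_conj, hre]
    push_cast
    ring
  refine ⟨PositiveLinearMap.mk₀ f fun x hx => ?_, ?_⟩
  · rw [hf x hx]
    exact_mod_cast hg x (by rwa [ProperCone.mem_positive])
  · change f (star a * a) ≠ 0
    rw [hf _ (star_mul_self_nonneg a)]
    rw [map_neg] at hga
    exact_mod_cast (by linarith : 0 < g (star a * a)).ne'

variable {H : Type u} [NormedAddCommGroup H] [InnerProductSpace ℂ H]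

/-- The weighted shift `(x n) ↦ (T n (x (s n)))` of `ℓ²(ℤ, H)`. -/
noncomputable def lpWeightedShift (s : ℤ ≃ ℤ) (T : ℤ → H →L[ℂ] H) (C : ℝ) (hT : ∀ n, ‖T n‖ ≤ C) :
    lp (fun _ : ℤ => H) 2 →L[ℂ] lp (fun _ : ℤ => H) 2 :=
  have hterm : ∀ (x : lp (fun _ : ℤ => H) 2) (n : ℤ),
      ‖T n (x (s n))‖ ^ (2 : ℝ≥0∞).toReal ≤ C ^ 2 * ‖x (s n)‖ ^ (2 : ℝ≥0∞).toReal := fun x n => by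
    simp only [ENNReal.toReal_ofNat, Real.rpow_two]
    rw [← mul_pow]
    refine pow_le_pow_left₀ (norm_nonneg _) ?_ 2
    exact (T n).le_of_opNorm_le (hT n) _
  have hsum : ∀ x : lp (fun _ : ℤ => H) 2,
      HasSum (fun n => C ^ 2 * ‖x (s n)‖ ^ (2 : ℝ≥0∞).toReal)
        (C ^ 2 * ‖x‖ ^ (2 : ℝ≥0∞).toReal) := fun x =>
    ((s.hasSum_iff (f := fun n => ‖x n‖ ^ (2 : ℝ≥0∞).toReal)).2
      (lp.hasSum_norm (by norm_num) x)).mul_left _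
  have hmem : ∀ x : lp (fun _ : ℤ => H) 2, Memℓp (fun n => T n (x (s n))) 2 := fun x =>
    memℓp_gen (Summable.of_nonneg_of_le (fun n => by positivity) (hterm x) (hsum x).summable)
  LinearMap.mkContinuous
    { toFun := fun x => ⟨fun n => T n (x (s n)), hmem x⟩
      map_add' := fun x y => by
        ext n
        simp only [lp.coeFn_add, Pi.add_apply, map_add]
      map_smul' := fun z x => by
        ext n
        simp } C fun x => by
    have hC : 0 ≤ C := (norm_nonneg _).trans (hT 0)
    refine lp.norm_le_of_tsum_le (by norm_num) (by positivity) ?_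
    have h := ((Summable.of_nonneg_of_le (fun n => by positivity) (hterm x)
      (hsum x).summable).tsum_le_tsum (hterm x) (hsum x).summable).trans_eq (hsum x).tsum_eq
    rw [Real.mul_rpow hC (norm_nonneg _)]
    simpa using h

theorem lpWeightedShift_apply (s : ℤ ≃ ℤ) (T : ℤ → H →L[ℂ] H) (C : ℝ) (hT : ∀ n, ‖T n‖ ≤ C)
    (x : lp (fun _ : ℤ => H) 2) (n : ℤ) : lpWeightedShift s T C hT x n = T n (x (s n)) := rfl

variable (H) in
/-- The bilateral shift on `ℓ²(ℤ, H)`. -/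
noncomputable def bilateralShift : lp (fun _ : ℤ => H) 2 →L[ℂ] lp (fun _ : ℤ => H) 2 :=
  lpWeightedShift (Equiv.subRight 1) (fun _ => 1) 1 fun _ => ContinuousLinearMap.norm_id_le

theorem bilateralShift_apply (x : lp (fun _ : ℤ => H) 2) (n : ℤ) :
    bilateralShift H x n = x (n - 1) := rfl

variable [CompleteSpace H]

/-- Reindex the sum defining the inner product by `s` and take adjoints termwise. -/
theorem star_lpWeightedShift (s : ℤ ≃ ℤ) (T T' : ℤ → H →L[ℂ] H) (C C' : ℝ) (hT : ∀ n, ‖T n‖ ≤ C)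
    (hT' : ∀ n, ‖T' n‖ ≤ C') (h : ∀ n, T' n = star (T (s.symm n))) :
    star (lpWeightedShift s T C hT) = lpWeightedShift s.symm T' C' hT' := by
  rw [ContinuousLinearMap.star_eq_adjoint, eq_comm, ContinuousLinearMap.eq_adjoint_iff]
  intro x y
  rw [lp.inner_eq_tsum, lp.inner_eq_tsum, ← s.tsum_eq]
  refine tsum_congr fun n => ?_
  rw [lpWeightedShift_apply, lpWeightedShift_apply, h, Equiv.symm_apply_apply,
    ContinuousLinearMap.star_eq_adjoint, ContinuousLinearMap.adjoint_inner_left]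

variable {A : Type u} [CStarAlgebra A]

/-- The representation `π(a) ξ(n) = ρ(α⁻ⁿ(a)) ξ(n)` on `ℓ²(ℤ, H)`. -/
noncomputable def regularRep (ρ : A →⋆ₐ[ℂ] (H →L[ℂ] H)) (α : A ≃⋆ₐ[ℂ] A) :
    A →⋆ₐ[ℂ] (lp (fun _ : ℤ => H) 2 →L[ℂ] lp (fun _ : ℤ => H) 2) where
  toFun a := lpWeightedShift (Equiv.refl ℤ) (fun n => ρ ((α ^ (-n)) a)) ‖a‖ fun n =>
    (NonUnitalStarAlgHom.norm_apply_le ρ _).trans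
      (NonUnitalStarAlgHom.norm_apply_le ((α ^ (-n) : A ≃⋆ₐ[ℂ] A) : A →⋆ₐ[ℂ] A) a)
  map_one' := by
    ext x n
    simp [lpWeightedShift_apply]
  map_mul' a b := by
    ext x n
    simp [lpWeightedShift_apply]
  map_zero' := by
    ext x n
    simp [lpWeightedShift_apply]
  map_add' a b := by
    ext x n
    simp [lpWeightedShift_apply]
  commutes' z := by
    ext x n
    simp [lpWeightedShift_apply, Algebra.algebraMap_eq_smul_one]
  map_star' a := by
    rw [star_lpWeightedShift]
    · rfl
    · intro n
      simp [map_star]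

theorem regularRep_apply (ρ : A →⋆ₐ[ℂ] (H →L[ℂ] H)) (α : A ≃⋆ₐ[ℂ] A) (a : A)
    (x : lp (fun _ : ℤ => H) 2) (n : ℤ) :
    regularRep ρ α a x n = ρ ((α ^ (-n)) a) (x n) := rfl

theorem star_bilateralShift_apply (x : lp (fun _ : ℤ => H) 2) (n : ℤ) :
    star (bilateralShift H) x n = x (n + 1) := by
  rw [bilateralShift, star_lpWeightedShift (T' := fun _ => 1) (C' := 1)
    (hT' := fun _ => ContinuousLinearMap.norm_id_le) (h := fun _ => (star_one _).symm)]
  rfl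

theorem bilateralShift_mem_unitary : bilateralShift H ∈ unitary _ := by
  rw [Unitary.mem_iff]
  constructor <;> ext x n
  · change star (bilateralShift H) (bilateralShift H x) n = x n
    rw [star_bilateralShift_apply, bilateralShift_apply, add_sub_cancel_right]
  · change bilateralShift H (star (bilateralShift H) x) n = x n
    rw [bilateralShift_apply, star_bilateralShift_apply, sub_add_cancel]

theorem bilateralShift_conj_regularRep (ρ : A →⋆ₐ[ℂ] (H →L[ℂ] H)) (α : A ≃⋆ₐ[ℂ] A) (a : A) :
    bilateralShift H * regularRep ρ α a * star (bilateralShift H) = regularRep ρ α (α a) := by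
  ext x n
  change bilateralShift H (regularRep ρ α a (star (bilateralShift H) x)) n = _
  rw [bilateralShift_apply, regularRep_apply, star_bilateralShift_apply, sub_add_cancel,
    regularRep_apply, neg_sub, sub_eq_neg_add, zpow_add, zpow_one]
  rfl

/-- Covariant representations separate the points of `A`. -/
theorem CovariantRep.exists_ne_zero (α : A ≃⋆ₐ[ℂ] A) {a : A} (ha : a ≠ 0) :
    ∃ ρ : CovariantRep A α, ρ.π a ≠ 0 := by
  let := CStarAlgebra.spectralOrder A
  have := CStarAlgebra.spectralOrderedRing A
  obtain ⟨f, hf⟩ := exists_positiveLinearMap_ne_zero ha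
  have hρ : f.gnsStarAlgHom a ≠ 0 := by
    intro h
    have h1 : f.gnsStarAlgHom a (f.toPreGNS 1) = 0 := by rw [h]; rfl
    have h2 : f.gnsStarAlgHom a (f.toPreGNS 1) = ((f.toPreGNS a : f.PreGNS) : f.GNS) := by
      simp
    rw [h2, ← norm_eq_zero, UniformSpace.Completion.norm_coe] at h1
    have h3 := f.preGNS_norm_sq (f.toPreGNS a)
    rw [h1, f.ofPreGNS_toPreGNS] at h3
    apply hf
    rw [← h3]
    simp
  -- The coordinate at `0` of the regular representation is the GNS representation itself.
  have hπ : regularRep f.gnsStarAlgHom α a ≠ 0 := by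
    intro h
    apply hρ
    ext ξ
    have h1 := regularRep_apply f.gnsStarAlgHom α a (lp.single 2 0 ξ) 0
    rw [h] at h1
    simp only [neg_zero, zpow_zero, lp.single_apply_self] at h1
    exact h1.symm
  exact ⟨{ carrier := lp (fun _ : ℤ => f.GNS) 2 →L[ℂ] lp (fun _ : ℤ => f.GNS) 2
           nontriv := ⟨_, _, hπ⟩
           π := regularRep f.gnsStarAlgHom α
           U := bilateralShift _
           unitary := bilateralShift_mem_unitary
           covariant := bilateralShift_conj_regularRep _ α }, hπ⟩

end RegularRepresentation

/-! ### The closed subalgebra asymptotically commuting with a sequence. -/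

section AsymptoticCommutant

variable {D : Type u} [CStarAlgebra D] {B : Type v} [CStarAlgebra B]

/-- The elements of `D` that, together with their adjoints, asymptotically commute with `x`. -/
def asymptoticCommutant (φ : D →⋆ₐ[ℂ] B) {x : ℕ → B} (hx : BoundedSeq x) : StarSubalgebra ℂ D :=
  have hS : ∀ c, EqModNull (fun n => x n * φ c) (fun n => φ c * x n) ↔
      seqClass x hx * seqClass _ (.const (φ c)) = seqClass _ (.const (φ c)) * seqClass x hx :=
    fun c => by
      rw [← seqClass_mul, ← seqClass_mul, seqClass_eq_iff]
  have hmul : ∀ c d, EqModNull (fun n => x n * φ c) (fun n => φ c * x n) →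
      EqModNull (fun n => x n * φ d) (fun n => φ d * x n) →
      EqModNull (fun n => x n * φ (c * d)) (fun n => φ (c * d) * x n) := fun c d hc hd => by
    rw [hS] at hc hd ⊢
    have : seqClass _ (.const (φ (c * d))) =
        seqClass _ (.const (φ c)) * seqClass _ (.const (φ d)) := by
      rw [← seqClass_mul]
      simp only [map_mul]
    rw [this, ← mul_assoc, hc, mul_assoc, hd, mul_assoc]
  have hadd : ∀ c d, EqModNull (fun n => x n * φ c) (fun n => φ c * x n) →
      EqModNull (fun n => x n * φ d) (fun n => φ d * x n) →
      EqModNull (fun n => x n * φ (c + d)) (fun n => φ (c + d) * x n) := fun c d hc hd => by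
    have h := Tendsto.add hc hd
    rw [add_zero] at h
    refine squeeze_zero (fun _ => norm_nonneg _) (fun n => ?_) h
    refine le_trans (le_of_eq ?_) (norm_add_le _ _)
    dsimp only
    rw [map_add, mul_add, add_mul, add_sub_add_comm]
  have halg : ∀ z : ℂ, EqModNull (fun n => x n * φ (algebraMap ℂ D z))
      (fun n => φ (algebraMap ℂ D z) * x n) := fun z => by
    unfold EqModNull
    simp [AlgHomClass.commutes, Algebra.commutes z]
  { carrier := {c | EqModNull (fun n => x n * φ c) (fun n => φ c * x n) ∧
      EqModNull (fun n => x n * φ (star c)) (fun n => φ (star c) * x n)}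
    mul_mem' := fun {c d} hc hd => ⟨hmul _ _ hc.1 hd.1, by
      rw [star_mul]
      exact hmul _ _ hd.2 hc.2⟩
    add_mem' := fun {c d} hc hd => ⟨hadd _ _ hc.1 hd.1, by
      rw [star_add]
      exact hadd _ _ hc.2 hd.2⟩
    algebraMap_mem' := fun z => ⟨halg z, by
      rw [← algebraMap_star_comm]
      exact halg _⟩
    star_mem' := fun {c} hc => ⟨hc.2, by
      rw [star_star]
      exact hc.1⟩ }

theorem mem_asymptoticCommutant {φ : D →⋆ₐ[ℂ] B} {x : ℕ → B} {hx : BoundedSeq x} {c : D} :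
    c ∈ asymptoticCommutant φ hx ↔ EqModNull (fun n => x n * φ c) (fun n => φ c * x n) ∧
      EqModNull (fun n => x n * φ (star c)) (fun n => φ (star c) * x n) := Iff.rfl

theorem isClosed_asymptoticCommutant (φ : D →⋆ₐ[ℂ] B) {x : ℕ → B} (hx : BoundedSeq x) :
    IsClosed (asymptoticCommutant φ hx : Set D) :=
  have hclosed : IsClosed {c : D | EqModNull (fun n => x n * φ c) (fun n => φ c * x n)} :=
    (isClosed_setOf_eqModNull_mul_comm hx).preimage (AddMonoidHomClass.continuous_of_bound φ 1
      fun y => by simpa using NonUnitalStarAlgHom.norm_apply_le φ y)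
  hclosed.inter (hclosed.preimage continuous_star)

/-- For a unitary the condition on the adjoint is automatic: `[x, U*] = -U* [x, U] U*`. -/
theorem mem_asymptoticCommutant_of_mem_unitary {φ : D →⋆ₐ[ℂ] B} {x : ℕ → B} (hx : BoundedSeq x)
    {u : D} (hu : u ∈ unitary D) (h : EqModNull (fun n => x n * φ u) (fun n => φ u * x n)) :
    u ∈ asymptoticCommutant φ hx := by
  refine ⟨h, ?_⟩
  have hU : φ u ∈ unitary B := Unitary.map_mem φ hu
  have : ∀ n, ‖x n * star (φ u) - star (φ u) * x n‖ = ‖x n * φ u - φ u * x n‖ := fun n => by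
    set U := φ u
    have e : x n * star U - star U * x n = -(star U * (x n * U - U * x n) * star U) := by
      rw [mul_sub, sub_mul, mul_assoc (star U) (x n * U), mul_assoc (x n),
        Unitary.mul_star_self_of_mem hU, ← mul_assoc (star U) U,
        Unitary.star_mul_self_of_mem hU, mul_one, one_mul, neg_sub]
    rw [e, norm_neg, CStarRing.norm_mul_mem_unitary _ (Unitary.star_mem hU),
      CStarRing.norm_mem_unitary_mul _ (Unitary.star_mem hU)]
  unfold EqModNull at *
  simpa only [map_star, this] using h

end AsymptoticCommutant

/-! ### Generators of the crossed product and transfer of (SI). -/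

section CrossedProductGenerators

variable {A : Type u} [CStarAlgebra A] (α : A ≃⋆ₐ[ℂ] A)

theorem CovariantProduct.of_mem (a : A) : CovariantProduct.of α a ∈ crossedProductSubalgebra α :=
  StarSubalgebra.le_topologicalClosure _ (StarAlgebra.subset_adjoin ℂ _ (Or.inl ⟨a, rfl⟩))

theorem CovariantProduct.u_mem : CovariantProduct.u α ∈ crossedProductSubalgebra α :=
  StarSubalgebra.le_topologicalClosure _ (StarAlgebra.subset_adjoin ℂ _ (Or.inr rfl))

namespace CrossedProduct

/-- The canonical inclusion of `A` in `A ⋊_α ℤ`. -/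
noncomputable def incl : A →⋆ₐ[ℂ] CrossedProduct α where
  toFun a := ⟨CovariantProduct.of α a, CovariantProduct.of_mem α a⟩
  map_one' := by
    apply Subtype.ext
    ext ρ
    exact map_one ρ.π
  map_mul' a b := by
    apply Subtype.ext
    ext ρ
    exact map_mul ρ.π a b
  map_zero' := by
    apply Subtype.ext
    ext ρ
    exact map_zero ρ.π
  map_add' a b := by
    apply Subtype.ext
    ext ρ
    exact map_add ρ.π a b
  commutes' z := by
    apply Subtype.ext
    ext ρ
    exact AlgHomClass.commutes ρ.π z
  map_star' a := by
    apply Subtype.ext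
    ext ρ
    exact map_star ρ.π a

/-- The canonical unitary of `A ⋊_α ℤ`. -/
noncomputable def canonicalUnitary : CrossedProduct α :=
  ⟨CovariantProduct.u α, CovariantProduct.u_mem α⟩

theorem canonicalUnitary_mem_unitary : canonicalUnitary α ∈ unitary (CrossedProduct α) := by
  rw [Unitary.mem_iff]
  constructor <;> apply Subtype.ext <;> ext ρ
  · exact Unitary.star_mul_self_of_mem ρ.unitary
  · exact Unitary.mul_star_self_of_mem ρ.unitary

theorem canonicalUnitary_conj_incl (a : A) :
    canonicalUnitary α * incl α a * star (canonicalUnitary α) = incl α (α a) := by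
  apply Subtype.ext
  ext ρ
  exact ρ.covariant a

theorem incl_injective : Function.Injective (incl α) := by
  rw [injective_iff_map_eq_zero]
  intro a ha
  by_contra hne
  obtain ⟨ρ, hρ⟩ := CovariantRep.exists_ne_zero α hne
  apply hρ
  exact congrFun (congrArg (fun x : CrossedProduct α => (x.1 : ∀ ρ, _)) ha) ρ

variable {α}

/-- The crossed product is generated by `A` and the canonical unitary. -/
theorem mem_of_isClosed {T : StarSubalgebra ℂ (CrossedProduct α)}
    (hT : IsClosed (T : Set (CrossedProduct α))) (hA : ∀ a, incl α a ∈ T)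
    (hu : canonicalUnitary α ∈ T) (c : CrossedProduct α) : c ∈ T := by
  -- The generated algebra lives in the ambient product and `T` in the subtype, so the induction
  -- carries a lift to `T`.
  have hadj : ∀ y ∈ StarAlgebra.adjoin ℂ
      (Set.range (CovariantProduct.of α) ∪ {CovariantProduct.u α}),
      ∃ c : CrossedProduct α, c ∈ T ∧ c.1 = y := by
    intro y hy
    induction hy using StarAlgebra.adjoin_induction with
    | mem y hy =>
      rcases hy with ⟨a, rfl⟩ | rfl
      · exact ⟨incl α a, hA a, rfl⟩
      · exact ⟨canonicalUnitary α, hu, rfl⟩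
    | algebraMap z => exact ⟨algebraMap ℂ _ z, T.algebraMap_mem z, rfl⟩
    | add y z _ _ hy hz =>
      obtain ⟨c, hc, rfl⟩ := hy
      obtain ⟨d, hd, rfl⟩ := hz
      exact ⟨c + d, T.add_mem hc hd, rfl⟩
    | mul y z _ _ hy hz =>
      obtain ⟨c, hc, rfl⟩ := hy
      obtain ⟨d, hd, rfl⟩ := hz
      exact ⟨c * d, T.mul_mem hc hd, rfl⟩
    | star y _ hy =>
      obtain ⟨c, hc, rfl⟩ := hy
      exact ⟨star c, star_mem hc, rfl⟩
  change c ∈ (T : Set (CrossedProduct α))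
  have hcl : closure (T : Set (CrossedProduct α)) =
      (Subtype.val : CrossedProduct α → CovariantProduct α) ⁻¹' closure (Subtype.val '' T.carrier) :=
    Topology.IsInducing.subtypeVal.closure_eq_preimage_closure_image _
  rw [← hT.closure_eq]
  refine hcl.ge ?_
  have hc : c.1 ∈ closure ((StarAlgebra.adjoin ℂ
      (Set.range (CovariantProduct.of α) ∪ {CovariantProduct.u α}) :
        StarSubalgebra ℂ (CovariantProduct α)) : Set (CovariantProduct α)) := c.2
  exact closure_mono (fun y hy => by
    obtain ⟨d, hd, rfl⟩ := hadj y hy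
    exact ⟨d, hd, rfl⟩) hc

/-- A sequence that asymptotically commutes with `A` and the canonical unitary asymptotically
commutes with the crossed product. -/
theorem representsRelCommutant {B : Type v} [CStarAlgebra B] {φ : CrossedProduct α →⋆ₐ[ℂ] B}
    {x : ℕ → B} (hx : RepresentsRelCommutant (φ.comp (incl α)) x)
    (hu : EqModNull (fun n => x n * φ (canonicalUnitary α))
      (fun n => φ (canonicalUnitary α) * x n)) : RepresentsRelCommutant φ x := by
  refine ⟨hx.1, fun c => ?_⟩
  refine (mem_asymptoticCommutant (hx := hx.1).1 (mem_of_isClosed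
    (isClosed_asymptoticCommutant φ hx.1) (fun a => ?_)
    (mem_asymptoticCommutant_of_mem_unitary hx.1 (canonicalUnitary_mem_unitary α) hu) c)).1
  refine mem_asymptoticCommutant.2 ⟨hx.2 a, ?_⟩
  rw [← map_star]
  exact hx.2 (star a)

/-- The small isometry for `A` yields one for the crossed product. -/
theorem smallIsometryExists [TopologicalSpace.SeparableSpace A] (htrace : HasUniqueTracialState A)
    (hα : RohlinProperty α) {B : Type v} [CStarAlgebra B] {φ : CrossedProduct α →⋆ₐ[ℂ] B}
    {e f : ℕ → B} (he : RepresentsCentralProjection φ e) (hf : RepresentsCentralProjection φ f)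
    (hft : TraceBoundedBelow φ f)
    (H : RepresentsCentralProjection (φ.comp (incl α)) e →
      ∀ g : ℕ → B, RepresentsCentralProjection (φ.comp (incl α)) g →
      TraceBoundedBelow (φ.comp (incl α)) g → SmallIsometryExists (φ.comp (incl α)) e g) :
    SmallIsometryExists φ e f := by
  obtain ⟨τ, hτ⟩ := htrace
  have hres : ∀ {g : ℕ → B}, RepresentsCentralProjection φ g →
      RepresentsCentralProjection (φ.comp (incl α)) g := fun hg =>
    ⟨⟨hg.1.1, fun a => hg.1.2 (incl α a)⟩, hg.2⟩
  -- Projections of `A` are projections of the crossed product, so condition (1) restricts with the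
  -- same constant.
  have hft' : TraceBoundedBelow (φ.comp (incl α)) f := by
    obtain ⟨c, hc, h⟩ := hft
    exact ⟨c, hc, fun p hp => h _ (hp.map_starAlgHom (incl α))⟩
  obtain ⟨w, hw, hwU, h⟩ := exists_invariant_smallIsometry hτ hα
    (Unitary.map_mem φ (canonicalUnitary_mem_unitary α))
    (fun a => by
      have := congrArg φ (canonicalUnitary_conj_incl α a)
      rwa [map_mul, map_mul, map_star] at this)
    (hres he) (hres hf) (he.1.2 _) (hf.1.2 _) hft' (H (hres he))
  exact ⟨w, representsRelCommutant hw hwU, h⟩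

end CrossedProduct

end CrossedProductGenerators

theorem proposition3p7 (A : Type u) [CStarAlgebra A] [TopologicalSpace.SeparableSpace A]
    (htrace : HasUniqueTracialState A) (hA : ProjectionOrderDeterminedByTraces A)
    (α : A ≃⋆ₐ[ℂ] A) (hα : RohlinProperty α)
    (hcross : ProjectionOrderDeterminedByTraces (CrossedProduct α)) :
    (PropertySI.{u, v} A → PropertySI.{u + 1, v} (CrossedProduct α)) ∧
      (UniformPropertySI.{u, v} A → UniformPropertySI.{u + 1, v} (CrossedProduct α)) := by
  constructor
  · intro hSI B _ hrr hord φ hφ e f he hf hft het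
    exact CrossedProduct.smallIsometryExists htrace hα he hf hft fun he' g hg hgt =>
      hSI B hrr hord _ (hφ.comp (CrossedProduct.incl_injective α)) e g he' hg hgt het
  · intro hSI B _ hrr hord φ hφ e f he hf hft het
    exact CrossedProduct.smallIsometryExists htrace hα he hf hft fun he' g hg hgt =>
      hSI B hrr hord _ (hφ.comp (CrossedProduct.incl_injective α)) e g he' hg hgt het
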